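/- Let $0\le c<1$ and let $x=(x_i)_{i\ge1}$, $y=(y_j)_{j\ge1}$ be absolutely summable sequences of complex numbers with $|x_i|\le c$ and $|y_j|\le c$ for all $i,j$. For $|z|c<1$ put $$Q_x(z)=\prod_{i}\frac{1+zx_i}{1-zx_i},\qquad \widetilde Q_x(z)=Q_x(z^{-1}),$$ and for a function $\psi$ on the unit circle with Fourier coefficients $(\psi_n)_{n\in\mathbb Z}$ let $T(\psi)=(\psi_{j-k})_{j,k\ge0}$ and $H(\psi)=(\psi_{j+k+1})_{j,k\ge0}$ be the Toeplitz and Hankel matrices, regarded as operators on $\ell^2(\{0,1,2,\dots\})$ over $\mathbb C$. Let $J$ be the diagonal operator with diagonal entries $(-1)^j$, and let $L_x$ be the matrix with entries $$(L_x)_{jk}=\Big(\frac1{2\pi i}\Big)^2\oint_{|z|=r}\oint_{|\zeta|=s}\frac{Q_x(z)\,Q_x(\zeta)}{z^{j+1}\zeta^{k+1}}\,\frac{d\zeta\,dz}{z+\zeta}\qquad(j,k\ge0),$$ where $r\ne s$ are any positive numbers with $rc<1$ and $sc<1$. Then: 1. The matrices $L_x$, $H(Q_x)$, $H(Q_x^{-1})$,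 $T(\widetilde Q_x)$, $T(\widetilde Q_x^{-1})$, $J$ define bounded operators on $\ell^2$, and $$L_x=H(Q_x)\,T(\widetilde Q_x^{-1})\,J=-J\,H(Q_x^{-1})\,T(\widetilde Q_x).$$ 2. Let $\phi(z)=Q_x(z)\,\widetilde Q_y(z)$. The matrices $T(\phi)$ and $T(\phi^{-1})$ define bounded operators on $\ell^2$, the operators $L_xL_y$ and $T(\phi)T(\phi^{-1})-I$ are trace class, the product $Z=\prod_{i,j}\frac{1+x_iy_j}{1-x_iy_j}$ converges, and the Fredholm determinants satisfy $$\det(I+L_xL_y)=\det T(\phi)\,T(\phi^{-1})=Z^2=\prod_{i,j}\Big(\frac{1+x_iy_j}{1-x_iy_j}\Big)^2.$$ -/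

import Mathlib

open scoped Real

namespace ShiftedSchur

noncomputable section

/-- The Hilbert space of square summable complex sequences indexed by the nonnegative integers. -/
abbrev Ell2 : Type := lp (fun _ : ℕ => ℂ) 2

/-- The canonical basis vector `e_k`. -/
def basisVec (k : ℕ) : Ell2 := lp.single 2 k (1 : ℂ)

/-- The `j, k` matrix entry `(e_j, A e_k)` of a bounded operator. -/
def entry (A : Ell2 →L[ℂ] Ell2) (j k : ℕ) : ℂ := A (basisVec k) j

/-- The bounded operator `A` has matrix `M` in the canonical basis. Such an `A` is determined
by `M`. -/
def HasMatrix (A : Ell2 →L[ℂ] Ell2) (M : ℕ → ℕ → ℂ) : Prop := ∀ j k, entry A j k = M j k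

/-- `M` is the matrix of some bounded operator. -/
def IsBoundedMatrix (M : ℕ → ℕ → ℂ) : Prop := ∃ A : Ell2 →L[ℂ] Ell2, HasMatrix A M

open Classical in
/-- The bounded operator with matrix `M` (zero by convention if `M` is not the matrix of a
bounded operator). -/
def matrixOp (M : ℕ → ℕ → ℂ) : Ell2 →L[ℂ] Ell2 :=
  if h : IsBoundedMatrix M then h.choose else 0

theorem hasMatrix_matrixOp {M : ℕ → ℕ → ℂ} (h : IsBoundedMatrix M) :
    HasMatrix (matrixOp M) M := by
  unfold matrixOp
  rw [dif_pos h]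
  exact h.choose_spec

/-- Trace class (nuclear) operators: `A = ∑ u_n ⊗ v_n` with `∑ ‖u_n‖ ‖v_n‖ < ∞`. -/
def IsTraceClass (A : Ell2 →L[ℂ] Ell2) : Prop :=
  ∃ u v : ℕ → Ell2, Summable (fun n => ‖u n‖ * ‖v n‖) ∧
    ∀ f : Ell2, HasSum (fun n => inner ℂ (v n) f • u n) (A f)

/-- The Fredholm determinant of `B = I + A`, for `A` trace class:
`det (I + A) = ∑_k Tr (Λ^k A)`, the trace being evaluated in the canonical basis, that is, the
sum of all finite principal minors of the matrix of `A`. -/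
def fredholmDet (B : Ell2 →L[ℂ] Ell2) : ℂ :=
  ∑' S : Finset ℕ, Matrix.det (Matrix.of fun i j : S => entry (B - 1) i j)

/-- The Fourier coefficient `ψ_n` of the restriction of `ψ` to the unit circle. -/
def symbolCoeff (ψ : ℂ → ℂ) (n : ℤ) : ℂ :=
  fourierCoeff (fun t : UnitAddCircle => ψ (AddCircle.toCircle t)) n

def toeplitzMatrix (ψ : ℂ → ℂ) (j k : ℕ) : ℂ := symbolCoeff ψ ((j : ℤ) - (k : ℤ))

def hankelMatrix (ψ : ℂ → ℂ) (j k : ℕ) : ℂ := symbolCoeff ψ ((j : ℤ) + (k : ℤ) + 1)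

def signMatrix (j k : ℕ) : ℂ := if j = k then (-1) ^ j else 0

/-- The Toeplitz operator `T(ψ)`. -/
def T (ψ : ℂ → ℂ) : Ell2 →L[ℂ] Ell2 := matrixOp (toeplitzMatrix ψ)

/-- The Hankel operator `H(ψ)`. -/
def H (ψ : ℂ → ℂ) : Ell2 →L[ℂ] Ell2 := matrixOp (hankelMatrix ψ)

/-- The diagonal operator with diagonal entries `(-1)^j`. -/
def J : Ell2 →L[ℂ] Ell2 := matrixOp signMatrix

/-- `Q_x(z) = ∏_i (1 + z x_i) / (1 - z x_i)`. -/
def Q (x : ℕ → ℂ) (z : ℂ) : ℂ := ∏' i, (1 + z * x i) / (1 - z * x i)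

/-- `ψ~(z) = ψ(1/z)`. -/
def tilde (ψ : ℂ → ℂ) (z : ℂ) : ℂ := ψ z⁻¹

/-- The matrix `L_x`, with the `z`-contour of radius `r` and the `ζ`-contour of radius `s`. -/
def LMatrix (r s : ℝ) (x : ℕ → ℂ) (j k : ℕ) : ℂ :=
  (1 / (2 * π * Complex.I)) ^ 2 *
    ∮ z in C(0, r), ∮ ζ in C(0, s),
      Q x z * Q x ζ / (z ^ (j + 1) * ζ ^ (k + 1)) * (1 / (z + ζ))

/-- The operator `L_x`. -/
def L (r s : ℝ) (x : ℕ → ℂ) : Ell2 →L[ℂ] Ell2 := matrixOp (LMatrix r s x)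

/-- The symbol `φ(z) = Q_x(z) Q_y(1/z)`. -/
def phi (x y : ℕ → ℂ) (z : ℂ) : ℂ := Q x z * tilde (Q y) z

/-- `Z = ∏_{i,j} (1 + x_i y_j) / (1 - x_i y_j)`. -/
def Z (x y : ℕ → ℂ) : ℂ := ∏' p : ℕ × ℕ, (1 + x p.1 * y p.2) / (1 - x p.1 * y p.2)

end

end ShiftedSchur

namespace ShiftedSchur

open Filter Topology
open scoped ENNReal

/-! Since `Q_x(z) Q_{-x}(z) = 1`, every inverse symbol is again of the form `Q`. The functions `Q_x`
have absolutely summable Fourier coefficients supported on `n ≥ 0`, so everything follows from two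
convolution identities, `T(ψχ) = T(ψ)T(χ) + H(ψ)H(χ̃)` and `H(ψχ) = T(ψ)H(χ) + H(ψ)T(χ̃)`, in which
one term drops out when a symbol is analytic. The factorization of `L_x` is a residue computation of
its entries.

In the product `L_x L_y` one factorization is used for `L_x` and the other for `L_y`, so that the
two copies of `J` cancel. Moving `T(Q̃_y)` around cyclically and commuting Toeplitz past Hankel
operators turns `I + L_x L_y`, up to equality of determinants, into the commutator `T(Q̃_y) T(Q_x)
T(Q̃_y)⁻¹ T(Q_x)⁻¹`, which is `T(φ)T(φ⁻¹)`.

The determinant of this commutator is multiplicative in the analytic symbol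
(`fredholmDet_commutator_mul`). For the symbol `1 - az` the commutator is the identity plus an
operator with only one nonzero row, and its determinant is `1 / Q_y(a)`
(`Admissible.fredholmDet_commutator_linear`). The factor `(1 + z x_i) / (1 - z x_i)` of `Q_x`
therefore contributes `Q_y(x_i)` twice, once from its numerator and once from its denominator; this
is why `Z` appears squared. Infinite products are reached as limits of finite ones.

The analysis stays at the level of matrix entries. Absolutely summable matrices form an ideal among
those with bounded absolute row and column sums. For summable matrices the sum of principal minors
converges and passes to dominated entrywise limits (`tendsto_fredholmDet`), so the algebraic rules
for determinants follow from the finite ones by truncation. -/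

/-- Bounded operators on `ℓ²`. -/
abbrev Op := Ell2 →L[ℂ] Ell2

/-! ### Operators and their matrix entries -/

theorem hasSum_basisVec (f : Ell2) : HasSum (fun k => f k • basisVec k) f := by
  have h := lp.hasSum_single (E := fun _ : ℕ => ℂ) (p := 2) ENNReal.ofNat_ne_top f
  simpa only [basisVec, ← lp.single_smul, smul_eq_mul, mul_one] using h

theorem basisVec_apply (k j : ℕ) : basisVec k j = if j = k then 1 else 0 := by
  unfold basisVec
  rw [lp.single_apply, Pi.single_apply]

theorem hasSum_apply (A : Op) (f : Ell2) (j : ℕ) :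
    HasSum (fun k => entry A j k * f k) (A f j) := by
  have h := ((hasSum_basisVec f).mapL A).mapL (lp.evalCLM ℂ (fun _ : ℕ => ℂ) 2 j)
  simp only [map_smul, smul_eq_mul, mul_comm (f _)] at h
  exact h

theorem hasSum_entry_mul (A B : Op) (j k : ℕ) :
    HasSum (fun n => entry A j n * entry B n k) (entry (A * B) j k) :=
  hasSum_apply A (B (basisVec k)) j

theorem op_ext {A B : Op} (h : ∀ j k, entry A j k = entry B j k) : A = B := by
  ext f j
  refine (hasSum_apply A f j).unique ?_
  simpa only [h] using hasSum_apply B f j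

theorem entry_one (j k : ℕ) : entry 1 j k = if j = k then 1 else 0 := basisVec_apply k j

theorem entry_zero (j k : ℕ) : entry 0 j k = 0 := rfl

theorem entry_add (A B : Op) (j k : ℕ) : entry (A + B) j k = entry A j k + entry B j k := rfl

theorem entry_neg (A : Op) (j k : ℕ) : entry (-A) j k = -entry A j k := rfl

theorem HasMatrix.matrixOp_eq {A : Op} {M : ℕ → ℕ → ℂ} (h : HasMatrix A M) : matrixOp M = A :=
  op_ext fun j k => (hasMatrix_matrixOp ⟨A, h⟩ j k).trans (h j k).symm

/-! ### The Schur test -/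

/-- All row sums and all column sums of the nonnegative matrix `m` are at most `C`. -/
structure SchurBounded (m : ℕ → ℕ → ℝ≥0∞) (C : ℝ≥0∞) : Prop where
  row : ∀ j, ∑' k, m j k ≤ C
  col : ∀ k, ∑' j, m j k ≤ C

theorem tsum_enorm_sq (f : Ell2) : ∑' k, ‖f k‖ₑ ^ 2 = ‖f‖ₑ ^ 2 := by
  have h := lp.hasSum_norm (p := 2) (by norm_num) f
  simp only [ENNReal.toReal_ofNat, Real.rpow_ofNat] at h
  have h2 := ENNReal.ofReal_tsum_of_nonneg (fun k => sq_nonneg ‖f k‖) h.summable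
  rw [h.tsum_eq] at h2
  simp only [ENNReal.ofReal_pow (norm_nonneg _), ofReal_norm] at h2
  exact h2.symm

theorem memlp_two_of_tsum {g : ℕ → ℂ} (h : ∑' k, ‖g k‖ₑ ^ 2 ≠ ⊤) :
    Memℓp (E := fun _ : ℕ => ℂ) g 2 := by
  refine memℓp_gen ?_
  have := ENNReal.summable_toReal h
  simpa using this

/-- Cauchy–Schwarz with weights `m`. The square is written as a double sum and `2ab ≤ a² + b²` is
applied to each pair of indices; this works in `ℝ≥0∞` without any finiteness assumption. -/
theorem sq_tsum_mul_le (m f : ℕ → ℝ≥0∞) :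
    (∑' k, m k * f k) ^ 2 ≤ (∑' k, m k) * ∑' k, m k * f k ^ 2 := by
  have h2 : ∀ a b : ℝ≥0∞, 2 * (a * b) ≤ a ^ 2 + b ^ 2 := by
    intro a b
    wlog hab : a ≤ b generalizing a b
    · rw [mul_comm a, add_comm]; exact this b a (le_of_not_ge hab)
    -- Writing `b = a + d` avoids the truncated subtraction of `ℝ≥0∞`.
    obtain ⟨d, rfl⟩ := exists_add_of_le hab
    calc 2 * (a * (a + d)) ≤ 2 * (a * (a + d)) + d ^ 2 := le_self_add
      _ = a ^ 2 + (a + d) ^ 2 := by ring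
  have h3 : ∀ a b c d : ℝ≥0∞, 2 * ((a * b) * (c * d)) ≤ a * (c * d ^ 2) + c * (a * b ^ 2) := by
    intro a b c d
    calc 2 * ((a * b) * (c * d)) = (a * c) * (2 * (b * d)) := by ring
      _ ≤ (a * c) * (b ^ 2 + d ^ 2) := by gcongr; exact h2 _ _
      _ = _ := by ring
  have h4 : 2 * (∑' k, m k * f k) ^ 2 ≤ 2 * ((∑' k, m k) * ∑' k, m k * f k ^ 2) := by
    calc 2 * (∑' k, m k * f k) ^ 2 = ∑' j, ∑' k, 2 * ((m j * f j) * (m k * f k)) := by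
          simp only [ENNReal.tsum_mul_left, ENNReal.tsum_mul_right, sq]
      _ ≤ ∑' j, ∑' k, (m j * (m k * f k ^ 2) + m k * (m j * f j ^ 2)) := by
          gcongr; exact h3 _ _ _ _
      _ = _ := by
          simp only [ENNReal.tsum_add, ENNReal.tsum_mul_left, ENNReal.tsum_mul_right, two_mul]
  exact (ENNReal.mul_le_mul_iff_right two_ne_zero ENNReal.ofNat_ne_top).1 h4

theorem enorm_apply_le (f : Ell2) (k : ℕ) : ‖f k‖ₑ ≤ ‖f‖ₑ :=
  by
  rw [← ofReal_norm, ← ofReal_norm]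
  exact ENNReal.ofReal_le_ofReal (lp.norm_apply_le_norm two_ne_zero f k)

/-- The Schur test. -/
theorem isBoundedMatrix_of_schurBounded {M : ℕ → ℕ → ℂ} {C : ℝ≥0∞} (hC : C ≠ ⊤)
    (h : SchurBounded (fun j k => ‖M j k‖ₑ) C) : IsBoundedMatrix M := by
  have hs : ∀ (f : Ell2) j, Summable fun k => M j k * f k := by
    intro f j
    refine Summable.of_enorm (ne_top_of_le_ne_top (ENNReal.mul_ne_top hC (enorm_ne_top (x := f))) ?_)
    calc ∑' k, ‖M j k * f k‖ₑ ≤ ∑' k, ‖M j k‖ₑ * ‖f‖ₑ := by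
          refine ENNReal.tsum_le_tsum fun k => ?_
          rw [enorm_mul]; gcongr; exact enorm_apply_le f k
      _ ≤ _ := by rw [ENNReal.tsum_mul_right]; gcongr; exact h.row j
  -- Weighted Cauchy–Schwarz in each row costs one factor `C` from the row sums; exchanging the sums
  -- costs another from the column sums.
  have hb : ∀ f : Ell2, ∑' j, ‖∑' k, M j k * f k‖ₑ ^ 2 ≤ (C * ‖f‖ₑ) ^ 2 := by
    intro f
    calc ∑' j, ‖∑' k, M j k * f k‖ₑ ^ 2 ≤ ∑' j, (∑' k, ‖M j k‖ₑ * ‖f k‖ₑ) ^ 2 := by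
          gcongr with j
          simp_rw [← enorm_mul]
          exact enorm_tsum_le_tsum_enorm
      _ ≤ ∑' j, C * ∑' k, ‖M j k‖ₑ * ‖f k‖ₑ ^ 2 := by
          gcongr with j
          refine (sq_tsum_mul_le _ _).trans ?_
          gcongr; exact h.row j
      _ = C * ∑' k, (∑' j, ‖M j k‖ₑ) * ‖f k‖ₑ ^ 2 := by
          rw [ENNReal.tsum_mul_left, ENNReal.tsum_comm]
          simp_rw [ENNReal.tsum_mul_right]
      _ ≤ C * ∑' k, C * ‖f k‖ₑ ^ 2 := by gcongr with k; exact h.col k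
      _ = _ := by rw [ENNReal.tsum_mul_left, tsum_enorm_sq]; ring
  have hm : ∀ f : Ell2, Memℓp (E := fun _ : ℕ => ℂ) (fun j => ∑' k, M j k * f k) 2 := fun f =>
    memlp_two_of_tsum (ne_top_of_le_ne_top
      (ENNReal.pow_ne_top (ENNReal.mul_ne_top hC enorm_ne_top)) (hb f))
  let A₀ : Ell2 →ₗ[ℂ] Ell2 :=
    { toFun := fun f => ⟨fun j => ∑' k, M j k * f k, hm f⟩
      map_add' := by
        intro f g
        ext j
        change ∑' k, M j k * (f k + g k) = ∑' k, M j k * f k + ∑' k, M j k * g k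
        simpa only [mul_add] using (hs f j).tsum_add (hs g j)
      map_smul' := by
        intro a f
        ext j
        simp [mul_left_comm _ a, tsum_mul_left] }
  refine ⟨A₀.mkContinuous C.toReal fun f => ?_, fun j k => ?_⟩
  · have h1 : ‖A₀ f‖ₑ ^ 2 ≤ (C * ‖f‖ₑ) ^ 2 := by
      rw [← tsum_enorm_sq]; exact hb f
    have h2 : ‖A₀ f‖ₑ ≤ C * ‖f‖ₑ := (ENNReal.pow_le_pow_left_iff two_ne_zero).1 h1
    have h3 := ENNReal.toReal_mono (ENNReal.mul_ne_top hC enorm_ne_top) h2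
    simpa using h3
  · change ∑' n, M j n * basisVec k n = M j k
    simp [basisVec_apply]

/-! ### Majorant matrices and dominated entrywise convergence -/

/-- The product of nonnegative infinite matrices. -/
noncomputable def mprod (m m' : ℕ → ℕ → ℝ≥0∞) (j k : ℕ) : ℝ≥0∞ := ∑' n, m j n * m' n k

/-- Nonnegative matrices with uniformly bounded row and column sums. -/
def IsSchur (m : ℕ → ℕ → ℝ≥0∞) : Prop := ∃ C : ℝ≥0∞, C ≠ ⊤ ∧ SchurBounded m C

/-- Nonnegative matrices with finite total sum. -/
def IsSumm (m : ℕ → ℕ → ℝ≥0∞) : Prop := ∑' j, ∑' k, m j k ≠ ⊤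

theorem IsSumm.isSchur {m : ℕ → ℕ → ℝ≥0∞} (h : IsSumm m) : IsSchur m := by
  refine ⟨_, h, fun j => ENNReal.le_tsum (f := fun j => ∑' k, m j k) j, fun k => ?_⟩
  rw [ENNReal.tsum_comm]
  exact ENNReal.le_tsum (f := fun k => ∑' j, m j k) k

theorem IsSumm.mono {m m' : ℕ → ℕ → ℝ≥0∞} (h : IsSumm m) (hle : ∀ j k, m' j k ≤ m j k) :
    IsSumm m' :=
  ne_top_of_le_ne_top h (ENNReal.tsum_le_tsum fun j => ENNReal.tsum_le_tsum fun k => hle j k)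

theorem IsSumm.add {m m' : ℕ → ℕ → ℝ≥0∞} (h : IsSumm m) (h' : IsSumm m') :
    IsSumm (fun j k => m j k + m' j k) := by
  unfold IsSumm
  simp only [ENNReal.tsum_add]
  exact ENNReal.add_ne_top.2 ⟨h, h'⟩

theorem SchurBounded.mprod {m m' : ℕ → ℕ → ℝ≥0∞} {C C' : ℝ≥0∞} (h : SchurBounded m C)
    (h' : SchurBounded m' C') : SchurBounded (mprod m m') (C * C') where
  row j := by
    calc ∑' k, ∑' n, m j n * m' n k = ∑' n, m j n * ∑' k, m' n k := by
          rw [ENNReal.tsum_comm]; simp_rw [ENNReal.tsum_mul_left]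
      _ ≤ ∑' n, m j n * C' := by gcongr; exact h'.row _
      _ ≤ C * C' := by rw [ENNReal.tsum_mul_right]; gcongr; exact h.row j
  col k := by
    calc ∑' j, ∑' n, m j n * m' n k = ∑' n, (∑' j, m j n) * m' n k := by
          rw [ENNReal.tsum_comm]; simp_rw [ENNReal.tsum_mul_right]
      _ ≤ ∑' n, C * m' n k := by gcongr; exact h.col _
      _ ≤ C * C' := by rw [ENNReal.tsum_mul_left]; gcongr; exact h'.col k

theorem IsSchur.mprod {m m' : ℕ → ℕ → ℝ≥0∞} (h : IsSchur m) (h' : IsSchur m') :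
    IsSchur (mprod m m') := by
  obtain ⟨C, hC, h⟩ := h
  obtain ⟨C', hC', h'⟩ := h'
  exact ⟨_, ENNReal.mul_ne_top hC hC', h.mprod h'⟩

theorem IsSumm.mprod_right {m m' : ℕ → ℕ → ℝ≥0∞} (h : IsSumm m) (h' : IsSchur m') :
    IsSumm (mprod m m') := by
  obtain ⟨C, hC, h'⟩ := h'
  refine ne_top_of_le_ne_top (ENNReal.mul_ne_top h hC) ?_
  calc ∑' j, ∑' k, ∑' n, m j n * m' n k = ∑' j, ∑' n, m j n * ∑' k, m' n k := by
        congr 1; ext j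
        rw [ENNReal.tsum_comm]; simp_rw [ENNReal.tsum_mul_left]
    _ ≤ ∑' j, ∑' n, m j n * C := by gcongr; exact h'.row _
    _ = _ := by simp_rw [ENNReal.tsum_mul_right]

theorem IsSumm.mprod_left {m m' : ℕ → ℕ → ℝ≥0∞} (h : IsSchur m) (h' : IsSumm m') :
    IsSumm (mprod m m') := by
  obtain ⟨C, hC, h⟩ := h
  refine ne_top_of_le_ne_top (ENNReal.mul_ne_top hC h') ?_
  calc ∑' j, ∑' k, ∑' n, m j n * m' n k = ∑' n, (∑' j, m j n) * ∑' k, m' n k := by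
        rw [ENNReal.tsum_comm]
        simp_rw [ENNReal.tsum_comm (f := fun j n => m j n * m' n _), ENNReal.tsum_mul_right]
        rw [ENNReal.tsum_comm]
        simp_rw [ENNReal.tsum_mul_left]
    _ ≤ ∑' n, C * ∑' k, m' n k := by gcongr; exact h.col _
    _ = _ := by simp_rw [ENNReal.tsum_mul_left]

theorem IsSchur.mprod_ne_top {m m' : ℕ → ℕ → ℝ≥0∞} (h : IsSchur m) (h' : IsSchur m') (j k : ℕ) :
    ShiftedSchur.mprod m m' j k ≠ ⊤ := by
  obtain ⟨C, hC, h⟩ := h.mprod h'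
  exact ne_top_of_le_ne_top hC ((ENNReal.le_tsum k).trans (h.row j))

theorem IsSchur.ne_top {m : ℕ → ℕ → ℝ≥0∞} (h : IsSchur m) (j k : ℕ) : m j k ≠ ⊤ := by
  obtain ⟨C, hC, h⟩ := h
  exact ne_top_of_le_ne_top hC ((ENNReal.le_tsum k).trans (h.row j))

/-- Entrywise convergence of operators, with entries dominated by `m`. -/
structure DomTendsto (A : ℕ → Op) (A₀ : Op) (m : ℕ → ℕ → ℝ≥0∞) : Prop where
  le : ∀ N j k, ‖entry (A N) j k‖ₑ ≤ m j k
  tendsto : ∀ j k, Tendsto (fun N => entry (A N) j k) atTop (𝓝 (entry A₀ j k))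

theorem DomTendsto.const {A : Op} {m : ℕ → ℕ → ℝ≥0∞} (h : ∀ j k, ‖entry A j k‖ₑ ≤ m j k) :
    DomTendsto (fun _ => A) A m :=
  ⟨fun _ => h, fun _ _ => tendsto_const_nhds⟩

theorem DomTendsto.add {A B : ℕ → Op} {A₀ B₀ : Op} {m m' : ℕ → ℕ → ℝ≥0∞}
    (h : DomTendsto A A₀ m) (h' : DomTendsto B B₀ m') :
    DomTendsto (fun N => A N + B N) (A₀ + B₀) (fun j k => m j k + m' j k) :=
  ⟨fun N j k => (enorm_add_le _ _).trans (add_le_add (h.le N j k) (h'.le N j k)),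
    fun j k => (h.tendsto j k).add (h'.tendsto j k)⟩

theorem enorm_entry_mul_le {A B : Op} {m m' : ℕ → ℕ → ℝ≥0∞} (h : ∀ j k, ‖entry A j k‖ₑ ≤ m j k)
    (h' : ∀ j k, ‖entry B j k‖ₑ ≤ m' j k) (j k : ℕ) : ‖entry (A * B) j k‖ₑ ≤ mprod m m' j k := by
  rw [← (hasSum_entry_mul A B j k).tsum_eq]
  refine enorm_tsum_le_tsum_enorm.trans (ENNReal.tsum_le_tsum fun n => ?_)
  rw [enorm_mul]
  exact mul_le_mul' (h j n) (h' n k)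

/-- Each entry of the product is a series dominated termwise by the series for `mprod m m'`, which
is finite by the Schur bounds. -/
theorem DomTendsto.mul {A B : ℕ → Op} {A₀ B₀ : Op} {m m' : ℕ → ℕ → ℝ≥0∞}
    (h : DomTendsto A A₀ m) (h' : DomTendsto B B₀ m') (hm : IsSchur m) (hm' : IsSchur m') :
    DomTendsto (fun N => A N * B N) (A₀ * B₀) (mprod m m') := by
  refine ⟨fun N => enorm_entry_mul_le (h.le N) (h'.le N), fun j k => ?_⟩
  simp only [← (hasSum_entry_mul _ _ j k).tsum_eq]
  refine tendsto_tsum_of_dominated_convergence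
    (bound := fun n => (m j n * m' n k).toReal)
    (ENNReal.summable_toReal (hm.mprod_ne_top hm' j k))
    (fun n => (h.tendsto j n).mul (h'.tendsto n k)) (Eventually.of_forall fun N n => ?_)
  have h1 : ‖entry (A N) j n * entry (B N) n k‖ₑ ≤ m j n * m' n k := by
    rw [enorm_mul]; exact mul_le_mul' (h.le N j n) (h'.le N n k)
  have h2 := ENNReal.toReal_mono (ENNReal.mul_ne_top (hm.ne_top j n) (hm'.ne_top n k)) h1
  rwa [toReal_enorm] at h2

/-! ### Continuity of the Fredholm determinant -/

/-- In the Leibniz expansion the sum over permutations is enlarged to a sum over all maps `n → n`,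
which factors into row sums. -/
theorem enorm_det_le {n : Type*} [Fintype n] [DecidableEq n] (M : Matrix n n ℂ) :
    ‖M.det‖ₑ ≤ ∏ i, ∑ j, ‖M i j‖ₑ := by
  classical
  rw [← Matrix.det_transpose, Matrix.det_apply']
  calc ‖∑ σ : Equiv.Perm n, ((Equiv.Perm.sign σ : ℤ) : ℂ) * ∏ i, M.transpose (σ i) i‖ₑ
      ≤ ∑ σ : Equiv.Perm n, ∏ i, ‖M i (σ i)‖ₑ := by
        refine (enorm_sum_le _ _).trans (Finset.sum_le_sum fun σ _ => ?_)
        rw [enorm_mul]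
        have h1 : ‖((Equiv.Perm.sign σ : ℤ) : ℂ)‖ₑ = 1 := by
          rcases Int.units_eq_one_or (Equiv.Perm.sign σ) with h | h <;> simp [h]
        rw [h1, one_mul]
        simp only [← ofReal_norm, norm_prod, Matrix.transpose_apply]
        rw [ENNReal.ofReal_prod_of_nonneg fun _ _ => norm_nonneg _]
    _ ≤ ∑ f : n → n, ∏ i, ‖M i (f i)‖ₑ := by
        rw [← Finset.sum_image (s := Finset.univ) (g := fun σ : Equiv.Perm n => (σ : n → n))
          (f := fun f : n → n => ∏ i, ‖M i (f i)‖ₑ) (fun a _ b _ h => DFunLike.coe_injective h)]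
        exact Finset.sum_le_sum_of_subset (Finset.subset_univ _)
    _ = _ := by rw [Finset.prod_univ_sum, Fintype.piFinset_univ]

/-- The principal minor of `K` on `S`. -/
noncomputable def minor (K : Op) (S : Finset ℕ) : ℂ :=
  Matrix.det (Matrix.of fun i j : S => entry K i j)

theorem fredholmDet_one_add (K : Op) : fredholmDet (1 + K) = ∑' S, minor K S := by
  simp only [fredholmDet, add_sub_cancel_left, minor]

theorem enorm_minor_le {K : Op} {m : ℕ → ℕ → ℝ≥0∞} (h : ∀ j k, ‖entry K j k‖ₑ ≤ m j k)
    (S : Finset ℕ) : ‖minor K S‖ₑ ≤ ∏ i ∈ S, ∑' k, m i k := by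
  refine (enorm_det_le _).trans ?_
  rw [← Finset.prod_coe_sort S fun i => ∑' k, m i k]
  gcongr with i
  rw [← tsum_fintype (L := .unconditional _)]
  calc ∑' j : S, ‖entry K i j‖ₑ ≤ ∑' j : S, m i j := by gcongr; exact h _ _
    _ ≤ _ := ENNReal.tsum_comp_le_tsum_of_injective Subtype.val_injective _

/-- The minor on `S` is at most the product over `S` of the row sums of `m`. These products are
summable over all finite `S` because the row sums are summable, so dominated convergence applies to
the sum of minors. -/
theorem tendsto_fredholmDet {K : ℕ → Op} {K₀ : Op} {m : ℕ → ℕ → ℝ≥0∞} (h : DomTendsto K K₀ m)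
    (hm : IsSumm m) :
    Tendsto (fun N => fredholmDet (1 + K N)) atTop (𝓝 (fredholmDet (1 + K₀))) := by
  simp only [fredholmDet_one_add]
  have hrow : ∀ i, ∑' k, m i k ≠ ⊤ := fun i => ENNReal.ne_top_of_tsum_ne_top hm i
  refine tendsto_tsum_of_dominated_convergence
    (bound := fun S => ∏ i ∈ S, (∑' k, m i k).toReal)
    (summable_finsetProd_of_summable_nonneg (fun _ => ENNReal.toReal_nonneg)
      (ENNReal.summable_toReal hm)) (fun S => ?_) (Eventually.of_forall fun N S => ?_)
  · exact (Continuous.matrix_det continuous_id).continuousAt.tendsto.comp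
      (tendsto_pi_nhds.2 fun i => tendsto_pi_nhds.2 fun j => h.tendsto i j)
  · have := ENNReal.toReal_mono (ENNReal.prod_ne_top fun i _ => hrow i) (enorm_minor_le (h.le N) S)
    rwa [toReal_enorm, ENNReal.toReal_prod] at this

/-! ### Truncation to finite matrices and the algebra of determinants -/

theorem diag_isBoundedMatrix {d : ℕ → ℂ} (hd : ∀ j, ‖d j‖ ≤ 1) :
    IsBoundedMatrix (fun j k => if j = k then d j else 0) := by
  have hd' : ∀ j, ‖d j‖ₑ ≤ 1 := fun j => by
    rw [← ofReal_norm]; exact ENNReal.ofReal_le_one.2 (hd j)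
  refine isBoundedMatrix_of_schurBounded ENNReal.one_ne_top ⟨fun j => ?_, fun k => ?_⟩
  · rw [tsum_eq_single j (fun k hk => by simp [hk.symm])]; simpa using hd' j
  · rw [tsum_eq_single k (fun j hj => by simp [hj])]; simpa using hd' k

/-- The compression of `A` to the span of the first `n` basis vectors. -/
noncomputable def trunc (n : ℕ) (A : Op) : Op :=
  matrixOp (fun j k => if j = k then (if j < n then 1 else 0) else 0) * A *
    matrixOp (fun j k => if j = k then (if j < n then 1 else 0) else 0)

theorem entry_trunc (n : ℕ) (A : Op) (j k : ℕ) :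
    entry (trunc n A) j k = if j < n ∧ k < n then entry A j k else 0 := by
  have hP := hasMatrix_matrixOp (diag_isBoundedMatrix (d := fun j => if j < n then 1 else 0)
    (fun j => by split_ifs <;> simp))
  rw [trunc, ← (hasSum_entry_mul _ _ j k).tsum_eq, tsum_eq_single k (fun i hi => by
      simp only [hP i k, if_neg hi, mul_zero]), hP k k,
    ← (hasSum_entry_mul _ _ j k).tsum_eq, tsum_eq_single j (fun i hi => by
      simp only [hP j i, if_neg hi.symm, zero_mul]), hP j j]
  split_ifs <;> simp_all
  omega

theorem domTendsto_trunc {A : Op} {m : ℕ → ℕ → ℝ≥0∞} (h : ∀ j k, ‖entry A j k‖ₑ ≤ m j k) :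
    DomTendsto (fun n => trunc n A) A m := by
  refine ⟨fun n j k => ?_, fun j k => ?_⟩
  · rw [entry_trunc]
    split_ifs
    · exact h j k
    · simp
  · refine tendsto_const_nhds.congr' ?_
    filter_upwards [eventually_gt_atTop (max j k)] with n hn
    rw [entry_trunc, if_pos (max_lt_iff.1 hn)]

/-- The leading `n × n` block of the matrix of `A`. -/
noncomputable def corner (n : ℕ) (A : Op) : Matrix (Fin n) (Fin n) ℂ := Matrix.of fun i j => entry A i j

theorem corner_trunc (n : ℕ) (A : Op) : corner n (trunc n A) = corner n A := by
  ext i j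
  simp [corner, entry_trunc]

theorem entry_trunc_mul_trunc (n : ℕ) (A B : Op) (j k : ℕ) :
    entry (trunc n A * trunc n B) j k =
      if j < n ∧ k < n then ∑ i : Fin n, entry A j i * entry B i k else 0 := by
  rw [← (hasSum_entry_mul _ _ j k).tsum_eq, tsum_eq_sum (s := Finset.range n) (fun i hi => by
    simp only [Finset.mem_range] at hi
    rw [entry_trunc, if_neg (by tauto), zero_mul]), Finset.sum_range]
  split_ifs with h
  · simp [entry_trunc, h.1, h.2]
  · refine Finset.sum_eq_zero fun i _ => ?_
    simp only [entry_trunc, i.2, true_and, and_true]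
    split_ifs <;> simp_all

/-- Multilinearity in the rows expands a finite `det (1 + K)` into the sum of principal minors of
`K`; the minors on sets not contained in `{0, …, n - 1}` vanish. -/
theorem fredholmDet_of_support {n : ℕ} {K : Op} (h : ∀ j k, ¬(j < n ∧ k < n) → entry K j k = 0) :
    fredholmDet (1 + K) = (1 + corner n K).det := by
  classical
  rw [fredholmDet_one_add, add_comm (1 : Matrix _ _ _)]
  have h1 : (corner n K + 1).det = ∑ s : Finset (Fin n), Matrix.det
      (Matrix.of (s.piecewise (corner n K).row (1 : Matrix (Fin n) (Fin n) ℂ).row)) :=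
    (Matrix.detRowAlternating (n := Fin n) (R := ℂ)).map_add_univ _ _
  simp_rw [h1, Matrix.det_piecewise_one_eq_submatrix_det]
  have hinj : Function.Injective (fun s : Finset (Fin n) => s.map Fin.valEmbedding) :=
    Finset.map_injective _
  rw [← hinj.tsum_eq (f := minor K), tsum_fintype]
  · refine Finset.sum_congr rfl fun s _ => ?_
    let e : s ≃ s.map Fin.valEmbedding := Equiv.ofBijective
      (fun i => ⟨i.1, Finset.mem_map_of_mem Fin.valEmbedding i.2⟩)
      ⟨fun a b h => Subtype.ext (Fin.ext (congrArg Subtype.val h)), fun ⟨b, hb⟩ => by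
        obtain ⟨a, ha, rfl⟩ := Finset.mem_map.1 hb
        exact ⟨⟨a, ha⟩, rfl⟩⟩
    rw [minor, ← Matrix.det_submatrix_equiv_self e]
    rfl
  · intro S hS
    by_contra hS'
    apply hS
    -- A set outside the image of `Finset (Fin n)` has an element `i ≥ n`, which gives a zero row in
    -- its minor.
    obtain ⟨i, hi, hin⟩ : ∃ i ∈ S, n ≤ i := by
      by_contra! hlt
      refine hS' ⟨Finset.univ.filter fun i : Fin n => (i : ℕ) ∈ S, ?_⟩
      ext a
      simp only [Finset.mem_map, Finset.mem_filter, Finset.mem_univ, true_and,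
        Fin.valEmbedding_apply]
      exact ⟨fun ⟨b, hb, hba⟩ => hba ▸ hb, fun ha => ⟨⟨a, hlt a ha⟩, ha, rfl⟩⟩
    exact Matrix.det_eq_zero_of_row_eq_zero ⟨i, hi⟩ fun j => h _ _ (by simp; omega)

/-- The compressions of `K` and `M` satisfy the identity by `Matrix.det_mul`. The product of
compressions is not the compression of the product, but it converges to `K * M` with a summable
majorant, which suffices. -/
theorem fredholmDet_mul {K M : Op} {m m' : ℕ → ℕ → ℝ≥0∞} (hK : ∀ j k, ‖entry K j k‖ₑ ≤ m j k)
    (hM : ∀ j k, ‖entry M j k‖ₑ ≤ m' j k) (hm : IsSumm m) (hm' : IsSumm m') :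
    fredholmDet ((1 + K) * (1 + M)) = fredholmDet (1 + K) * fredholmDet (1 + M) := by
  have e : ∀ K M : Op, (1 + K) * (1 + M) = 1 + (K + M + K * M) := fun K M => by noncomm_ring
  have t1 := tendsto_fredholmDet (domTendsto_trunc hK) hm
  have t2 := tendsto_fredholmDet (domTendsto_trunc hM) hm'
  have t3 := tendsto_fredholmDet (((domTendsto_trunc hK).add (domTendsto_trunc hM)).add
    ((domTendsto_trunc hK).mul (domTendsto_trunc hM) hm.isSchur hm'.isSchur))
    ((hm.add hm').add (hm.mprod_right hm'.isSchur))
  rw [e]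
  refine tendsto_nhds_unique t3 ((t1.mul t2).congr fun n => ?_)
  rw [fredholmDet_of_support (n := n) (fun j k h => by rw [entry_trunc, if_neg h]),
    fredholmDet_of_support (n := n) (fun j k h => by rw [entry_trunc, if_neg h]),
    fredholmDet_of_support (n := n) (fun j k h => by
      simp only [entry_add, entry_trunc, entry_trunc_mul_trunc, if_neg h, add_zero]),
    ← Matrix.det_mul, corner_trunc, corner_trunc]
  congr 1
  have : corner n (trunc n K + trunc n M + trunc n K * trunc n M) =
      corner n K + corner n M + corner n K * corner n M := by
    ext i j
    simp [corner, entry_add, entry_trunc, entry_trunc_mul_trunc, Matrix.mul_apply]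
  rw [this]
  noncomm_ring

/-- Only one factor has to be summable, since summable matrices form a two-sided ideal in the Schur
bounded ones. This allows Toeplitz factors to be moved cyclically. -/
theorem fredholmDet_mul_comm {A B : Op} {m m' : ℕ → ℕ → ℝ≥0∞} (hA : ∀ j k, ‖entry A j k‖ₑ ≤ m j k)
    (hB : ∀ j k, ‖entry B j k‖ₑ ≤ m' j k) (hm : IsSumm m) (hm' : IsSchur m') :
    fredholmDet (1 + A * B) = fredholmDet (1 + B * A) := by
  have t1 := tendsto_fredholmDet
    ((domTendsto_trunc hA).mul (domTendsto_trunc hB) hm.isSchur hm') (hm.mprod_right hm')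
  have t2 := tendsto_fredholmDet
    ((domTendsto_trunc hB).mul (domTendsto_trunc hA) hm' hm.isSchur) (.mprod_left hm' hm)
  refine tendsto_nhds_unique t1 (t2.congr fun n => ?_)
  have hc : ∀ A B : Op, corner n (trunc n A * trunc n B) = corner n A * corner n B := by
    intro A B
    ext i j
    simp [corner, entry_trunc_mul_trunc, Matrix.mul_apply]
  have hs : ∀ A B : Op, ∀ j k, ¬(j < n ∧ k < n) → entry (trunc n A * trunc n B) j k = 0 :=
    fun A B j k h => by rw [entry_trunc_mul_trunc, if_neg h]
  rw [fredholmDet_of_support (hs _ _), fredholmDet_of_support (hs _ _), hc, hc,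
    Matrix.det_one_add_mul_comm]

/-- If only the first row of `K` is nonzero, then `det (I + K) = 1 + K₀₀`. -/
theorem fredholmDet_of_first_row {K : Op} (h : ∀ j k, j ≠ 0 → entry K j k = 0) :
    fredholmDet (1 + K) = 1 + entry K 0 0 := by
  classical
  rw [fredholmDet_one_add, tsum_eq_sum (s := {∅, {0}})]
  · rw [Finset.sum_pair (by simp)]
    congr 1
    · simp [minor]
    · simp [minor]
  · intro S hS
    obtain ⟨i, hi, h0⟩ : ∃ i ∈ S, i ≠ 0 := by
      by_contra! h0
      exact hS (by simpa using Finset.subset_singleton_iff.1 fun i hi => by simpa using h0 i hi)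
    exact Matrix.det_eq_zero_of_row_eq_zero ⟨i, hi⟩ fun j => h _ _ h0

/-- The decomposition is `K = ∑ K e_n ⊗ e_n`; the `ℓ²` norm of a column is at most its `ℓ¹` norm,
and the latter are summable. -/
theorem isTraceClass_of_isSumm {K : Op} {m : ℕ → ℕ → ℝ≥0∞} (h : ∀ j k, ‖entry K j k‖ₑ ≤ m j k)
    (hm : IsSumm m) : IsTraceClass K := by
  refine ⟨fun n => K (basisVec n), basisVec, ?_, fun f => ?_⟩
  · have hb : ∀ n, ‖basisVec n‖ = 1 := fun n => by
      rw [basisVec, lp.norm_single (by norm_num), norm_one]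
    simp only [hb, mul_one]
    refine Summable.of_enorm (ne_top_of_le_ne_top hm ?_)
    rw [ENNReal.tsum_comm]
    gcongr with n
    have h1 : ‖K (basisVec n)‖ₑ ^ 2 ≤ (∑' j, ‖entry K j n‖ₑ) ^ 2 := by
      rw [← tsum_enorm_sq, sq (∑' j, _), ← ENNReal.tsum_mul_right]
      refine ENNReal.tsum_le_tsum fun j => ?_
      rw [sq]
      exact mul_le_mul' le_rfl (ENNReal.le_tsum (f := fun j => ‖entry K j n‖ₑ) j)
    rw [enorm_norm]
    refine ((ENNReal.pow_le_pow_left_iff two_ne_zero).1 h1).trans ?_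
    gcongr
    exact h _ _
  · have := (hasSum_basisVec f).mapL K
    simp only [map_smul] at this
    have hi : ∀ n, inner ℂ (basisVec n) f = f n := fun n => by
      rw [basisVec, lp.inner_single_left]; simp
    simpa only [hi] using this

/-! ### Absolutely convergent Fourier series -/

theorem symbolCoeff_congr {ψ χ : ℂ → ℂ} (h : ∀ z, ‖z‖ = 1 → ψ z = χ z) (n : ℤ) :
    symbolCoeff ψ n = symbolCoeff χ n := by
  unfold symbolCoeff
  congr 1
  ext t
  exact h _ (Circle.norm_coe _)

/-- Absolute summability permits termwise integration against the characters, and orthogonality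
picks out `a n`. -/
theorem symbolCoeff_eq {ψ : ℂ → ℂ} {a : ℤ → ℂ} (ha : Summable fun n => ‖a n‖)
    (h : ∀ z, ‖z‖ = 1 → HasSum (fun n => a n * z ^ n) (ψ z)) (n : ℤ) : symbolCoeff ψ n = a n := by
  have hf : ∀ m (t : UnitAddCircle), fourier m t = ((AddCircle.toCircle t : Circle) : ℂ) ^ m := by
    intro m t
    rw [fourier_apply, AddCircle.toCircle_zsmul, Circle.coe_zpow]
  have hn : ∀ m (t : UnitAddCircle), ‖(fourier m t : ℂ)‖ = 1 := fun m t => by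
    rw [fourier_apply, Circle.norm_coe]
  have key := MeasureTheory.hasSum_integral_of_summable_integral_norm
    (μ := AddCircle.haarAddCircle (T := 1))
    (F := fun (m : ℤ) (t : UnitAddCircle) => fourier (-n) t • (a m * fourier m t))
    (fun m => ((fourier (T := 1) (-n)).continuous.smul
      (continuous_const.mul (fourier m).continuous)).integrable_of_hasCompactSupport
        (HasCompactSupport.of_compactSpace _))
    (by simp only [norm_smul, norm_mul, hn, one_mul, mul_one]; simpa using ha)
  have h1 : ∀ m, ∫ t : UnitAddCircle, fourier (-n) t • (a m * fourier m t)
      ∂AddCircle.haarAddCircle = if m = n then a m else 0 := by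
    intro m
    have := fourierCoeff.const_mul (T := 1) (fun t => fourier m t) (a m) n
    rw [fourierCoeff] at this
    rw [this, show (fun t : UnitAddCircle => (fourier m t : ℂ)) = fourier m from rfl,
      fourierCoeff_fourier, Pi.single_apply]
    by_cases hmn : m = n
    · rw [if_pos hmn.symm, if_pos hmn, mul_one]
    · rw [if_neg (Ne.symm hmn), if_neg hmn, mul_zero]
  simp only [h1] at key
  have h2 := key.unique (hasSum_ite_eq n (a n) |>.congr_fun fun m => by
    split_ifs with hm <;> simp [hm])
  rw [← h2, symbolCoeff, fourierCoeff]
  refine MeasureTheory.integral_congr_ae (Eventually.of_forall fun t => ?_)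
  dsimp only
  simp only [smul_eq_mul]
  rw [tsum_mul_left]
  simp only [hf]
  rw [(h _ (Circle.norm_coe _)).tsum_eq]

attribute [local irreducible] symbolCoeff

/-- Functions which on the unit circle are the sum of an absolutely convergent Fourier series. -/
structure IsWiener (ψ : ℂ → ℂ) : Prop where
  summable : Summable fun n => ‖symbolCoeff ψ n‖
  hasSum : ∀ z, ‖z‖ = 1 → HasSum (fun n => symbolCoeff ψ n * z ^ n) (ψ z)

theorem IsWiener.of_hasSum {ψ : ℂ → ℂ} {a : ℤ → ℂ} (ha : Summable fun n => ‖a n‖)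
    (h : ∀ z, ‖z‖ = 1 → HasSum (fun n => a n * z ^ n) (ψ z)) : IsWiener ψ := by
  have := symbolCoeff_eq ha h
  exact ⟨by simpa only [this] using ha, by simpa only [this] using h⟩

theorem IsWiener.congr {ψ χ : ℂ → ℂ} (hψ : IsWiener ψ) (h : ∀ z, ‖z‖ = 1 → ψ z = χ z) :
    IsWiener χ := by
  refine .of_hasSum hψ.summable fun z hz => ?_
  rw [← h z hz]
  exact hψ.hasSum z hz

theorem IsWiener.tilde_aux {ψ : ℂ → ℂ} (hψ : IsWiener ψ) (z : ℂ) (hz : ‖z‖ = 1) :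
    HasSum (fun n => symbolCoeff ψ (-n) * z ^ n) (tilde ψ z) := by
  have := hψ.hasSum z⁻¹ (by simp [hz])
  simp only [inv_zpow'] at this
  have h2 := (Equiv.neg ℤ).hasSum_iff.2 this
  simpa [Function.comp_def, tilde] using h2

theorem IsWiener.symbolCoeff_tilde {ψ : ℂ → ℂ} (hψ : IsWiener ψ) (n : ℤ) :
    symbolCoeff (tilde ψ) n = symbolCoeff ψ (-n) :=
  symbolCoeff_eq (a := fun n => symbolCoeff ψ (-n)) ((Equiv.neg ℤ).summable_iff (f := fun n => ‖symbolCoeff ψ n‖) |>.2 hψ.summable)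
    hψ.tilde_aux n

theorem IsWiener.tilde {ψ : ℂ → ℂ} (hψ : IsWiener ψ) : IsWiener (tilde ψ) :=
  .of_hasSum (a := fun n => symbolCoeff ψ (-n)) ((Equiv.neg ℤ).summable_iff (f := fun n => ‖symbolCoeff ψ n‖) |>.2 hψ.summable)
    hψ.tilde_aux

theorem tilde_tilde (ψ : ℂ → ℂ) : tilde (tilde ψ) = ψ := by
  ext z; simp [tilde]

/-- The shear `(n, m) ↦ (n - m, m)`. -/
def shear : ℤ × ℤ ≃ ℤ × ℤ := (Equiv.prodComm _ _).trans
  ((Equiv.prodShear (Equiv.refl ℤ) fun m => Equiv.subRight m).trans (Equiv.prodComm _ _))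

theorem shear_apply (p : ℤ × ℤ) : shear p = (p.1 - p.2, p.2) := rfl

theorem summable_conv {a b : ℤ → ℂ} (ha : Summable fun n => ‖a n‖) (hb : Summable fun n => ‖b n‖) :
    Summable fun p : ℤ × ℤ => ‖a (p.1 - p.2) * b p.2‖ := by
  have h := (ha.mul_norm hb).comp_injective shear.injective
  simpa only [Function.comp_def, shear_apply] using h

/-- The absolutely convergent double series is sheared so that its fibres are the terms of constant
total degree. -/
theorem hasSum_conv {a b : ℤ → ℂ} (ha : Summable fun n => ‖a n‖) (hb : Summable fun n => ‖b n‖)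
    {z s t : ℂ} (hz : ‖z‖ = 1) (has : HasSum (fun n => a n * z ^ n) s)
    (hbt : HasSum (fun n => b n * z ^ n) t) :
    HasSum (fun n => (∑' m, a (n - m) * b m) * z ^ n) (s * t) := by
  have hz0 : z ≠ 0 := fun h => by simp [h] at hz
  have hsm := summable_mul_of_summable_norm (f := fun n : ℤ => a n * z ^ n)
    (g := fun n : ℤ => b n * z ^ n)
    (by simpa only [norm_mul, norm_zpow, hz, one_zpow, mul_one] using ha)
    (by simpa only [norm_mul, norm_zpow, hz, one_zpow, mul_one] using hb)
  have h1 := has.mul hbt hsm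
  have h2 : HasSum (fun p : ℤ × ℤ => a (p.1 - p.2) * z ^ (p.1 - p.2) * (b p.2 * z ^ p.2))
      (s * t) := by
    rw [← shear.hasSum_iff] at h1
    simpa only [Function.comp_def, shear_apply] using h1
  refine h2.prod_fiberwise fun n => ?_
  refine (((summable_conv ha hb).prod_factor n).of_norm.hasSum.mul_right (z ^ n)).congr_fun
    fun m => ?_
  dsimp only
  rw [zpow_sub₀ hz0]
  field_simp

theorem IsWiener.mul_aux {ψ χ : ℂ → ℂ} (hψ : IsWiener ψ) (hχ : IsWiener χ) :
    (Summable fun n => ‖∑' m, symbolCoeff ψ (n - m) * symbolCoeff χ m‖) ∧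
    (∀ n, Summable fun m => symbolCoeff ψ (n - m) * symbolCoeff χ m) ∧
    ∀ z, ‖z‖ = 1 →
      HasSum (fun n => (∑' m, symbolCoeff ψ (n - m) * symbolCoeff χ m) * z ^ n) ((ψ * χ) z) := by
  have hs := summable_conv hψ.summable hχ.summable
  refine ⟨?_, fun n => (hs.prod_factor n).of_norm, fun z hz =>
    hasSum_conv hψ.summable hχ.summable hz (hψ.hasSum z hz) (hχ.hasSum z hz)⟩
  exact hs.prod.of_nonneg_of_le (fun _ => norm_nonneg _)
    fun n => norm_tsum_le_tsum_norm (hs.prod_factor n)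

theorem IsWiener.mul {ψ χ : ℂ → ℂ} (hψ : IsWiener ψ) (hχ : IsWiener χ) : IsWiener (ψ * χ) :=
  .of_hasSum (hψ.mul_aux hχ).1 (hψ.mul_aux hχ).2.2

theorem IsWiener.hasSum_symbolCoeff_mul {ψ χ : ℂ → ℂ} (hψ : IsWiener ψ) (hχ : IsWiener χ) (n : ℤ) :
    HasSum (fun m => symbolCoeff ψ (n - m) * symbolCoeff χ m) (symbolCoeff (ψ * χ) n) := by
  rw [symbolCoeff_eq (hψ.mul_aux hχ).1 (hψ.mul_aux hχ).2.2]
  exact ((hψ.mul_aux hχ).2.1 n).hasSum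

/-- The total mass of the Fourier coefficients. -/
noncomputable def wienerNorm (ψ : ℂ → ℂ) : ℝ≥0∞ := ∑' n, ‖symbolCoeff ψ n‖ₑ

theorem IsWiener.wienerNorm_ne_top {ψ : ℂ → ℂ} (hψ : IsWiener ψ) : wienerNorm ψ ≠ ⊤ := by
  have := hψ.summable.tsum_ofReal_ne_top
  simp only [ofReal_norm] at this
  exact this

/-! ### Toeplitz and Hankel operators with Wiener symbols -/

theorem schurBounded_toeplitzMatrix (ψ : ℂ → ℂ) :
    SchurBounded (fun j k => ‖toeplitzMatrix ψ j k‖ₑ) (wienerNorm ψ) where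
  row j := ENNReal.tsum_comp_le_tsum_of_injective (f := fun k : ℕ => (j : ℤ) - k)
    (fun a b h => by simpa using h) fun n => ‖symbolCoeff ψ n‖ₑ
  col k := ENNReal.tsum_comp_le_tsum_of_injective (f := fun j : ℕ => (j : ℤ) - k)
    (fun a b h => by simpa using h) fun n => ‖symbolCoeff ψ n‖ₑ

theorem schurBounded_hankelMatrix (ψ : ℂ → ℂ) :
    SchurBounded (fun j k => ‖hankelMatrix ψ j k‖ₑ) (wienerNorm ψ) where
  row j := ENNReal.tsum_comp_le_tsum_of_injective (f := fun k : ℕ => (j : ℤ) + k + 1)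
    (fun a b h => by simpa using h) fun n => ‖symbolCoeff ψ n‖ₑ
  col k := ENNReal.tsum_comp_le_tsum_of_injective (f := fun j : ℕ => (j : ℤ) + k + 1)
    (fun a b h => by simpa using h) fun n => ‖symbolCoeff ψ n‖ₑ

theorem IsWiener.isSchur_toeplitz {ψ : ℂ → ℂ} (hψ : IsWiener ψ) :
    IsSchur fun j k => ‖toeplitzMatrix ψ j k‖ₑ :=
  ⟨_, hψ.wienerNorm_ne_top, schurBounded_toeplitzMatrix ψ⟩

theorem IsWiener.isSchur_hankel {ψ : ℂ → ℂ} (hψ : IsWiener ψ) :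
    IsSchur fun j k => ‖hankelMatrix ψ j k‖ₑ :=
  ⟨_, hψ.wienerNorm_ne_top, schurBounded_hankelMatrix ψ⟩

theorem IsWiener.isBoundedMatrix_toeplitz {ψ : ℂ → ℂ} (hψ : IsWiener ψ) :
    IsBoundedMatrix (toeplitzMatrix ψ) :=
  isBoundedMatrix_of_schurBounded hψ.wienerNorm_ne_top (schurBounded_toeplitzMatrix ψ)

theorem IsWiener.isBoundedMatrix_hankel {ψ : ℂ → ℂ} (hψ : IsWiener ψ) :
    IsBoundedMatrix (hankelMatrix ψ) :=
  isBoundedMatrix_of_schurBounded hψ.wienerNorm_ne_top (schurBounded_hankelMatrix ψ)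

theorem IsWiener.entry_T {ψ : ℂ → ℂ} (hψ : IsWiener ψ) (j k : ℕ) :
    entry (T ψ) j k = symbolCoeff ψ (j - k) :=
  hasMatrix_matrixOp hψ.isBoundedMatrix_toeplitz j k

theorem IsWiener.entry_H {ψ : ℂ → ℂ} (hψ : IsWiener ψ) (j k : ℕ) :
    entry (H ψ) j k = symbolCoeff ψ (j + k + 1) :=
  hasMatrix_matrixOp hψ.isBoundedMatrix_hankel j k

theorem T_congr {ψ χ : ℂ → ℂ} (h : ∀ z, ‖z‖ = 1 → ψ z = χ z) : T ψ = T χ := by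
  have : toeplitzMatrix ψ = toeplitzMatrix χ := by
    ext j k; exact symbolCoeff_congr h _
  rw [T, T, this]

theorem H_congr {ψ χ : ℂ → ℂ} (h : ∀ z, ‖z‖ = 1 → ψ z = χ z) : H ψ = H χ := by
  have : hankelMatrix ψ = hankelMatrix χ := by
    ext j k; exact symbolCoeff_congr h _
  rw [H, H, this]

/-- The coefficient of index `j - k` is `∑ ψ_{j-n} χ_{n-k}` over `n ∈ ℤ`. The terms with `n ≥ 0`
form the Toeplitz product; those with `n < 0`, after `n ↦ -(n + 1)`, form the Hankel product. -/
theorem T_mul {ψ χ : ℂ → ℂ} (hψ : IsWiener ψ) (hχ : IsWiener χ) :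
    T (ψ * χ) = T ψ * T χ + H ψ * H (tilde χ) := by
  refine op_ext fun j k => ?_
  rw [(hψ.mul hχ).entry_T, entry_add]
  have h0 := hψ.hasSum_symbolCoeff_mul hχ (j - k)
  have h1 := (Equiv.subRight (k : ℤ)).hasSum_iff.2 h0
  refine h1.unique (HasSum.of_nat_of_neg_add_one ?_ ?_)
  · convert hasSum_entry_mul (T ψ) (T χ) j k using 2 with n
    rw [hψ.entry_T, hχ.entry_T]
    simp
  · convert hasSum_entry_mul (H ψ) (H (tilde χ)) j k using 2 with n
    rw [hψ.entry_H, hχ.tilde.entry_H, hχ.symbolCoeff_tilde]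
    simp only [Function.comp_apply, Equiv.subRight_apply]
    congr 2 <;> ring

/-- The same splitting at `n = 0`, applied to `∑ ψ_{j-n} χ_{n+k+1}`. -/
theorem H_mul {ψ χ : ℂ → ℂ} (hψ : IsWiener ψ) (hχ : IsWiener χ) :
    H (ψ * χ) = T ψ * H χ + H ψ * T (tilde χ) := by
  refine op_ext fun j k => ?_
  rw [(hψ.mul hχ).entry_H, entry_add]
  have h0 := hψ.hasSum_symbolCoeff_mul hχ (j + k + 1)
  have h1 := (Equiv.addRight ((k : ℤ) + 1)).hasSum_iff.2 h0
  refine h1.unique (HasSum.of_nat_of_neg_add_one ?_ ?_)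
  · convert hasSum_entry_mul (T ψ) (H χ) j k using 2 with n
    rw [hψ.entry_T, hχ.entry_H]
    simp only [Function.comp_apply, Equiv.coe_addRight]
    congr 2
    ring
  · convert hasSum_entry_mul (H ψ) (T (tilde χ)) j k using 2 with n
    rw [hψ.entry_H, hχ.tilde.entry_T, hχ.symbolCoeff_tilde]
    simp only [Function.comp_apply, Equiv.coe_addRight]
    congr 2 <;> ring

theorem symbolCoeff_one (n : ℤ) : symbolCoeff 1 n = if n = 0 then 1 else 0 := by
  refine symbolCoeff_eq (a := fun n => if n = 0 then 1 else 0) ?_ (fun z hz => ?_) n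
  · exact summable_of_ne_finset_zero (s := {0}) fun n hn => by simp_all
  · change HasSum _ 1
    convert hasSum_ite_eq (0 : ℤ) (1 : ℂ) using 2 with n
    split_ifs with h
    · rw [h, zpow_zero, one_mul]
    · rw [zero_mul]

theorem isWiener_one : IsWiener 1 := by
  refine .of_hasSum (a := fun n => if n = 0 then 1 else 0) ?_ (fun z hz => ?_)
  · exact summable_of_ne_finset_zero (s := {0}) fun n hn => by simp_all
  · change HasSum _ 1
    convert hasSum_ite_eq (0 : ℤ) (1 : ℂ) using 2 with n
    split_ifs with h
    · rw [h, zpow_zero, one_mul]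
    · rw [zero_mul]

theorem T_one : T 1 = 1 := by
  refine op_ext fun j k => ?_
  rw [isWiener_one.entry_T, symbolCoeff_one, entry_one]
  simp [sub_eq_zero]

/-- Wiener functions all of whose negative Fourier coefficients vanish. -/
structure IsAnalyticWiener (ψ : ℂ → ℂ) : Prop extends IsWiener ψ where
  coeff_neg : ∀ n < 0, symbolCoeff ψ n = 0

theorem IsAnalyticWiener.H_tilde {ψ : ℂ → ℂ} (hψ : IsAnalyticWiener ψ) : H (tilde ψ) = 0 := by
  refine op_ext fun j k => ?_
  rw [hψ.tilde.entry_H, hψ.symbolCoeff_tilde, entry_zero]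
  exact hψ.coeff_neg _ (by omega)

theorem H_one : H 1 = 0 := by
  refine op_ext fun j k => ?_
  rw [isWiener_one.entry_H, symbolCoeff_one, entry_zero, if_neg (by omega)]

/-- `T(ψ χ) = T(ψ) T(χ)` for analytic `χ`. -/
theorem T_mul_analytic {ψ χ : ℂ → ℂ} (hψ : IsWiener ψ) (hχ : IsAnalyticWiener χ) :
    T (ψ * χ) = T ψ * T χ := by
  rw [T_mul hψ hχ.1, hχ.H_tilde, mul_zero, add_zero]

/-- `T(ψ̃ χ) = T(ψ̃) T(χ)` for analytic `ψ`. -/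
theorem T_tilde_mul {ψ χ : ℂ → ℂ} (hψ : IsAnalyticWiener ψ) (hχ : IsWiener χ) :
    T (tilde ψ * χ) = T (tilde ψ) * T χ := by
  rw [T_mul hψ.tilde hχ, hψ.H_tilde, zero_mul, add_zero]

/-- `H(ψ̃ χ) = T(ψ̃) H(χ)` for analytic `ψ`. -/
theorem H_tilde_mul {ψ χ : ℂ → ℂ} (hψ : IsAnalyticWiener ψ) (hχ : IsWiener χ) :
    H (tilde ψ * χ) = T (tilde ψ) * H χ := by
  rw [H_mul hψ.tilde hχ, hψ.H_tilde, zero_mul, add_zero]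

/-- `H(ψ χ̃) = H(ψ) T(χ)` for analytic `χ`. -/
theorem H_mul_tilde {ψ χ : ℂ → ℂ} (hψ : IsWiener ψ) (hχ : IsAnalyticWiener χ) :
    H (ψ * tilde χ) = H ψ * T χ := by
  rw [H_mul hψ hχ.tilde, hχ.H_tilde, mul_zero, zero_add, tilde_tilde]

theorem IsAnalyticWiener.of_hasSum {ψ : ℂ → ℂ} {a : ℕ → ℂ} (ha : Summable fun n => ‖a n‖)
    (h : ∀ z, ‖z‖ = 1 → HasSum (fun n => a n * z ^ n) (ψ z)) :
    IsAnalyticWiener ψ ∧ ∀ n : ℕ, symbolCoeff ψ n = a n := by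
  let b : ℤ → ℂ := fun n => if n < 0 then 0 else a n.toNat
  have hbn : ∀ n : ℕ, b n = a n := fun n => if_neg (by omega)
  have hb : Summable fun n => ‖b n‖ := by
    refine Summable.of_nat_of_neg_add_one ?_ ?_
    · simpa only [hbn] using ha
    · refine summable_zero.congr fun n => ?_
      rw [show b (-(n + 1)) = 0 from if_pos (by omega), norm_zero]
  have hb2 : ∀ z, ‖z‖ = 1 → HasSum (fun n => b n * z ^ n) (ψ z) := by
    intro z hz
    rw [← add_zero (ψ z)]
    refine HasSum.of_nat_of_neg_add_one ?_ ?_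
    · simpa only [hbn, zpow_natCast] using h z hz
    · convert (hasSum_zero : HasSum (fun _ : ℕ => (0 : ℂ)) 0) using 2 with n
      rw [show b (-(n + 1)) = 0 from if_pos (by omega), zero_mul]
  have := symbolCoeff_eq hb hb2
  refine ⟨⟨.of_hasSum hb hb2, fun n hn => ?_⟩, fun n => ?_⟩
  · rw [this]; exact if_pos hn
  · rw [this, hbn]

/-! ### The function `Q_x`: product, Taylor series and bounds -/

/-- Absolutely summable sequences bounded by `c`. -/
structure Admissible (c : ℝ) (x : ℕ → ℂ) : Prop where
  summable : Summable fun i => ‖x i‖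
  bound : ∀ i, ‖x i‖ ≤ c

theorem Admissible.nonneg {c : ℝ} {x : ℕ → ℂ} (hx : Admissible c x) : 0 ≤ c :=
  (norm_nonneg _).trans (hx.bound 0)

theorem Admissible.neg {c : ℝ} {x : ℕ → ℂ} (hx : Admissible c x) : Admissible c (-x) :=
  ⟨by simpa using hx.summable, by simpa using hx.bound⟩

theorem exists_radius_gt {c ρ : ℝ} (h : ρ * c < 1) : ∃ R, ρ < R ∧ R * c < 1 := by
  have h1 : ∀ᶠ R in 𝓝[>] ρ, R * c < 1 :=
    ((continuous_id.mul continuous_const).tendsto' ρ (ρ * c) rfl |>.eventually_lt_const h)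
      |>.filter_mono nhdsWithin_le_nhds
  obtain ⟨R, hR, hR'⟩ := (h1.and self_mem_nhdsWithin).exists
  exact ⟨R, hR', hR⟩

theorem one_sub_le_norm_one_sub_mul {c ρ : ℝ} {z a : ℂ} (hz : ‖z‖ ≤ ρ) (ha : ‖a‖ ≤ c) :
    1 - ρ * c ≤ ‖1 - z * a‖ := by
  have h1 : ‖z * a‖ ≤ ρ * c := by
    rw [norm_mul]
    exact mul_le_mul hz ha (norm_nonneg _) ((norm_nonneg _).trans hz)
  have h2 := norm_sub_norm_le (1 : ℂ) (z * a)
  rw [norm_one] at h2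
  linarith

theorem one_sub_mul_ne_zero {c : ℝ} {z a : ℂ} (hz : ‖z‖ * c < 1) (ha : ‖a‖ ≤ c) :
    1 - z * a ≠ 0 := by
  intro h
  have := one_sub_le_norm_one_sub_mul (z := z) le_rfl ha
  rw [h, norm_zero] at this
  linarith

theorem one_add_mul_ne_zero {c : ℝ} {z a : ℂ} (hz : ‖z‖ * c < 1) (ha : ‖a‖ ≤ c) :
    1 + z * a ≠ 0 := by
  simpa using one_sub_mul_ne_zero (a := -a) hz (by simpa using ha)

theorem factor_eq {c : ℝ} {z a : ℂ} (hz : ‖z‖ * c < 1) (ha : ‖a‖ ≤ c) :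
    (1 + z * a) / (1 - z * a) = 1 + 2 * z * a / (1 - z * a) := by
  have := one_sub_mul_ne_zero hz ha
  field_simp
  ring

theorem norm_factor_le {c ρ : ℝ} {z a : ℂ} (hz : ‖z‖ ≤ ρ) (hρ : ρ * c < 1) (ha : ‖a‖ ≤ c) :
    ‖2 * z * a / (1 - z * a)‖ ≤ 2 * ρ / (1 - ρ * c) * ‖a‖ := by
  have h := one_sub_le_norm_one_sub_mul hz ha
  have h0 : 0 < 1 - ρ * c := by linarith
  have hρ0 : 0 ≤ ρ := (norm_nonneg _).trans hz
  rw [norm_div, norm_mul, norm_mul, Complex.norm_ofNat, div_mul_eq_mul_div]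
  gcongr

theorem mul_lt_one_of_le {c ρ R : ℝ} (hc : 0 ≤ c) (h : ρ ≤ R) (hR : R * c < 1) : ρ * c < 1 :=
  (mul_le_mul_of_nonneg_right h hc).trans_lt hR

theorem Admissible.hasProd_Q {c : ℝ} {x : ℕ → ℂ} (hx : Admissible c x) {z : ℂ}
    (hz : ‖z‖ * c < 1) : HasProd (fun i => (1 + z * x i) / (1 - z * x i)) (Q x z) := by
  refine Multipliable.hasProd ?_
  simp only [factor_eq hz (hx.bound _)]
  exact multipliable_one_add_of_summable ((hx.summable.mul_left _).of_nonneg_of_le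
    (fun _ => norm_nonneg _) fun i => norm_factor_le le_rfl hz (hx.bound i))

theorem Admissible.differentiableOn_Q {c R : ℝ} {x : ℕ → ℂ} (hx : Admissible c x)
    (hR : R * c < 1) : DifferentiableOn ℂ (Q x) (Metric.ball 0 R) := by
  have hz : ∀ z ∈ Metric.ball (0 : ℂ) R, ‖z‖ * c < 1 := fun z hz =>
    mul_lt_one_of_le hx.nonneg (by simpa using (mem_ball_zero_iff.1 hz).le) hR
  have hd : ∀ i, DifferentiableOn ℂ (fun z => 2 * z * x i / (1 - z * x i)) (Metric.ball 0 R) :=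
    fun i => DifferentiableOn.div (by fun_prop) (by fun_prop) fun z h =>
      one_sub_mul_ne_zero (hz z h) (hx.bound i)
  have hu := Summable.hasProdLocallyUniformlyOn_one_add (f := fun i z => 2 * z * x i / (1 - z * x i))
    Metric.isOpen_ball (hx.summable.mul_left (2 * R / (1 - R * c)))
    (Eventually.of_forall fun i z h => norm_factor_le (mem_ball_zero_iff.1 h).le hR (hx.bound i))
    (fun i => (hd i).continuousOn)
  refine (hu.differentiableOn (Eventually.of_forall fun s => ?_) Metric.isOpen_ball).congr ?_
  · exact DifferentiableOn.fun_finsetProd fun i _ => (hd i).const_add 1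
  · intro z h
    exact tprod_congr fun i => factor_eq (hz z h) (hx.bound i)

/-- The factors cancel one by one. This lets `Q (-x)` replace the inverse of `Q x` throughout. -/
theorem Admissible.Q_mul_Q_neg {c : ℝ} {x : ℕ → ℂ} (hx : Admissible c x) {z : ℂ}
    (hz : ‖z‖ * c < 1) : Q x z * Q (-x) z = 1 := by
  refine ((hx.hasProd_Q hz).mul (hx.neg.hasProd_Q hz)).unique ?_
  convert hasProd_one with i
  have h1 := one_sub_mul_ne_zero hz (hx.bound i)
  have h2 := one_add_mul_ne_zero hz (hx.bound i)
  simp only [Pi.neg_apply, mul_neg, sub_neg_eq_add]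
  rw [← sub_eq_add_neg]
  field_simp

theorem Admissible.inv_Q {c : ℝ} {x : ℕ → ℂ} (hx : Admissible c x) {z : ℂ}
    (hz : ‖z‖ * c < 1) : (Q x)⁻¹ z = Q (-x) z :=
  inv_eq_of_mul_eq_one_right (hx.Q_mul_Q_neg hz)

theorem Q_neg_apply (x : ℕ → ℂ) (z : ℂ) : Q (-x) z = Q x (-z) := by
  simp [Q]

/-- A bound for `Q` on the disc of radius `ρ`. -/
noncomputable def QBound (c ρ S : ℝ) : ℝ := Real.exp (2 * ρ / (1 - ρ * c) * S)

/-- Each factor `1 + u` has norm at most `exp ‖u‖`. The bound depends on `x` only through `c` and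
`S`, hence is uniform over truncations of a sequence. -/
theorem Admissible.norm_Q_le {c ρ S : ℝ} {x : ℕ → ℂ} (hx : Admissible c x) (hρ : ρ * c < 1)
    (hS : ∑' i, ‖x i‖ ≤ S) {z : ℂ} (hz : ‖z‖ ≤ ρ) : ‖Q x z‖ ≤ QBound c ρ S := by
  have hρ0 : 0 ≤ ρ := (norm_nonneg _).trans hz
  have h0 : 0 < 1 - ρ * c := by linarith
  have hz' := mul_lt_one_of_le hx.nonneg hz hρ
  refine le_of_tendsto (hx.hasProd_Q hz').norm (Eventually.of_forall fun s => ?_)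
  rw [← norm_prod]
  calc ‖∏ i ∈ s, (1 + z * x i) / (1 - z * x i)‖
      ≤ ∏ i ∈ s, Real.exp (2 * ρ / (1 - ρ * c) * ‖x i‖) := by
        rw [norm_prod]
        refine Finset.prod_le_prod (fun _ _ => norm_nonneg _) fun i _ => ?_
        rw [factor_eq hz' (hx.bound i)]
        refine (norm_add_le _ _).trans ?_
        rw [norm_one, add_comm]
        exact (add_le_add_left (norm_factor_le hz hρ (hx.bound i)) 1).trans (Real.add_one_le_exp _)
    _ = Real.exp (2 * ρ / (1 - ρ * c) * ∑ i ∈ s, ‖x i‖) := by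
        rw [← Real.exp_sum, Finset.mul_sum]
    _ ≤ QBound c ρ S := by
        unfold QBound
        gcongr
        exact (hx.summable.sum_le_tsum s fun _ _ => norm_nonneg _).trans hS

/-- The Taylor coefficients of `Q` at the origin. -/
noncomputable def qCoeff (x : ℕ → ℂ) (n : ℕ) : ℂ := (n.factorial : ℂ)⁻¹ * iteratedDeriv n (Q x) 0

theorem Admissible.hasSum_qCoeff {c : ℝ} {x : ℕ → ℂ} (hx : Admissible c x) {z : ℂ}
    (hz : ‖z‖ * c < 1) : HasSum (fun n => qCoeff x n * z ^ n) (Q x z) := by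
  obtain ⟨R, hR, hRc⟩ := exists_radius_gt hz
  have := Complex.hasSum_taylorSeries_on_ball (hx.differentiableOn_Q hRc) (z := z) (by simpa using hR)
  refine this.congr_fun fun n => ?_
  simp only [qCoeff, smul_eq_mul, sub_zero]
  ring

theorem Admissible.differentiableOn_Q_closedBall {c R : ℝ} {x : ℕ → ℂ} (hx : Admissible c x)
    (hR : R * c < 1) : DifferentiableOn ℂ (Q x) (Metric.closedBall 0 R) := by
  obtain ⟨R', hR', hRc⟩ := exists_radius_gt hR
  exact (hx.differentiableOn_Q hRc).mono (Metric.closedBall_subset_ball hR')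

/-- Cauchy's estimate on the circle of radius `ρ`. As `c < 1`, some `ρ > 1` is allowed, which yields
geometric decay. -/
theorem Admissible.norm_qCoeff_le {c ρ S : ℝ} {x : ℕ → ℂ} (hx : Admissible c x) (hρ : ρ * c < 1)
    (hρ0 : 0 < ρ) (hS : ∑' i, ‖x i‖ ≤ S) (n : ℕ) : ‖qCoeff x n‖ ≤ QBound c ρ S * ρ⁻¹ ^ n := by
  have h := Complex.norm_iteratedDeriv_le_of_forall_mem_sphere_norm_le (f := Q x) n hρ0
    ((hx.differentiableOn_Q_closedBall hρ).diffContOnCl_ball subset_rfl)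
    (fun z hz => hx.norm_Q_le hρ hS (mem_sphere_zero_iff_norm.1 hz).le)
  rw [qCoeff, norm_mul, norm_inv, Complex.norm_natCast]
  calc (n.factorial : ℝ)⁻¹ * ‖iteratedDeriv n (Q x) 0‖
      ≤ (n.factorial : ℝ)⁻¹ * (n.factorial * QBound c ρ S / ρ ^ n) := by gcongr
    _ = _ := by
        have : (n.factorial : ℝ) ≠ 0 := by positivity
        rw [inv_pow]
        field_simp

theorem Admissible.analyticWiener_Q {c : ℝ} (hc : c < 1) {x : ℕ → ℂ} (hx : Admissible c x) :
    IsAnalyticWiener (Q x) ∧ ∀ n : ℕ, symbolCoeff (Q x) n = qCoeff x n := by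
  obtain ⟨ρ, h1, hρ⟩ := exists_radius_gt (ρ := 1) (c := c) (by linarith)
  refine IsAnalyticWiener.of_hasSum ?_ fun z hz => hx.hasSum_qCoeff (by rwa [hz, one_mul])
  have hρ0 : 0 < ρ := by linarith
  exact ((summable_geometric_of_lt_one (by positivity) (inv_lt_one_of_one_lt₀ h1)).mul_left
    _).of_nonneg_of_le (fun _ => norm_nonneg _) (hx.norm_qCoeff_le hρ hρ0 le_rfl)

theorem Admissible.isAnalyticWiener_Q {c : ℝ} (hc : c < 1) {x : ℕ → ℂ} (hx : Admissible c x) :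
    IsAnalyticWiener (Q x) :=
  (hx.analyticWiener_Q hc).1

theorem Admissible.symbolCoeff_Q {c : ℝ} (hc : c < 1) {x : ℕ → ℂ} (hx : Admissible c x) (n : ℕ) :
    symbolCoeff (Q x) n = qCoeff x n :=
  (hx.analyticWiener_Q hc).2 n

theorem qCoeff_neg (x : ℕ → ℂ) (n : ℕ) : qCoeff (-x) n = (-1) ^ n * qCoeff x n := by
  have h : Q (-x) = fun z => Q x (-z) := funext (Q_neg_apply x)
  rw [qCoeff, qCoeff, h, iteratedDeriv_comp_neg, neg_zero, smul_eq_mul]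
  ring

/-! ### Finite truncations of the parameters and the product `Z` -/

/-- The sequence `x` with all terms from the `N`-th on replaced by zero. -/
def truncSeq (N : ℕ) (x : ℕ → ℂ) (i : ℕ) : ℂ := if i < N then x i else 0

theorem norm_truncSeq_le (N : ℕ) (x : ℕ → ℂ) (i : ℕ) : ‖truncSeq N x i‖ ≤ ‖x i‖ := by
  unfold truncSeq
  split_ifs <;> simp

theorem Admissible.truncSeq {c : ℝ} {x : ℕ → ℂ} (hx : Admissible c x) (N : ℕ) :
    Admissible c (truncSeq N x) :=
  ⟨hx.summable.of_nonneg_of_le (fun _ => norm_nonneg _) (norm_truncSeq_le N x),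
    fun i => (norm_truncSeq_le N x i).trans (hx.bound i)⟩

theorem Admissible.tsum_truncSeq_le {c : ℝ} {x : ℕ → ℂ} (hx : Admissible c x) (N : ℕ) :
    ∑' i, ‖ShiftedSchur.truncSeq N x i‖ ≤ ∑' i, ‖x i‖ :=
  (hx.truncSeq N).summable.tsum_le_tsum (norm_truncSeq_le N x) hx.summable

theorem Q_truncSeq (N : ℕ) (x : ℕ → ℂ) (z : ℂ) :
    Q (truncSeq N x) z = ∏ i ∈ Finset.range N, (1 + z * x i) / (1 - z * x i) := by
  rw [Q, tprod_eq_prod (s := Finset.range N)]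
  · refine Finset.prod_congr rfl fun i hi => ?_
    rw [truncSeq, if_pos (Finset.mem_range.1 hi)]
  · intro i hi
    rw [truncSeq, if_neg (by simpa using hi)]
    simp

theorem Admissible.tendsto_Q_truncSeq {c : ℝ} {x : ℕ → ℂ} (hx : Admissible c x) {z : ℂ}
    (hz : ‖z‖ * c < 1) : Tendsto (fun N => Q (ShiftedSchur.truncSeq N x) z) atTop (𝓝 (Q x z)) := by
  simp only [Q_truncSeq]
  exact (hx.hasProd_Q hz).tendsto_prod_nat

theorem Admissible.continuous_Q_circle {c : ℝ} (hc : c < 1) {x : ℕ → ℂ} (hx : Admissible c x) :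
    Continuous fun t : UnitAddCircle => Q x (AddCircle.toCircle t) := by
  have h := (hx.differentiableOn_Q_closedBall (R := 1) (by linarith)).continuousOn
  refine h.comp_continuous (continuous_subtype_val.comp AddCircle.continuous_toCircle) fun t => ?_
  simpa using (Circle.norm_coe _).le

theorem Admissible.tendsto_symbolCoeff_truncSeq {c : ℝ} (hc : c < 1) {x : ℕ → ℂ}
    (hx : Admissible c x) (n : ℤ) :
    Tendsto (fun N => symbolCoeff (Q (ShiftedSchur.truncSeq N x)) n) atTop
      (𝓝 (symbolCoeff (Q x) n)) := by
  have h1c : (1 : ℝ) * c < 1 := by linarith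
  unfold symbolCoeff fourierCoeff
  refine MeasureTheory.tendsto_integral_of_dominated_convergence
    (fun _ => QBound c 1 (∑' i, ‖x i‖)) (fun N => ?_) (MeasureTheory.integrable_const _)
    (fun N => Eventually.of_forall fun t => ?_) (Eventually.of_forall fun t => ?_)
  · exact ((fourier (-n)).continuous.smul
      ((hx.truncSeq N).continuous_Q_circle hc)).aestronglyMeasurable
  · rw [norm_smul, fourier_apply, Circle.norm_coe, one_mul]
    exact (hx.truncSeq N).norm_Q_le h1c (hx.tsum_truncSeq_le N) (Circle.norm_coe _).le
  · exact (hx.tendsto_Q_truncSeq (by rwa [Circle.norm_coe])).const_smul _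

theorem Admissible.multipliable_Z {c : ℝ} (hc : c < 1) {x y : ℕ → ℂ} (hx : Admissible c x)
    (hy : Admissible c y) :
    Multipliable fun p : ℕ × ℕ => (1 + x p.1 * y p.2) / (1 - x p.1 * y p.2) := by
  have hcc : c * c < 1 := by nlinarith [hx.nonneg]
  simp only [factor_eq (mul_lt_one_of_le hy.nonneg (hx.bound _) hcc) (hy.bound _)]
  refine multipliable_one_add_of_summable ?_
  refine ((hx.summable.mul_of_nonneg hy.summable (fun _ => norm_nonneg _)
    fun _ => norm_nonneg _).mul_left (2 / (1 - c * c))).of_nonneg_of_le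
    (fun _ => norm_nonneg _) fun p => ?_
  have h1 := one_sub_le_norm_one_sub_mul (hx.bound p.1) (hy.bound p.2)
  have h0 : 0 < 1 - c * c := by linarith
  rw [norm_div, norm_mul, norm_mul, Complex.norm_ofNat, mul_assoc, div_mul_eq_mul_div]
  gcongr

/-- For fixed `i` the product over `j` is `Q_y(x_i)`, so the double product is taken fibrewise. -/
theorem Admissible.tendsto_Z {c : ℝ} (hc : c < 1) {x y : ℕ → ℂ} (hx : Admissible c x)
    (hy : Admissible c y) :
    Tendsto (fun N => ∏ i ∈ Finset.range N, Q y (x i)) atTop (𝓝 (Z x y)) := by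
  have hcc : c * c < 1 := by nlinarith [hx.nonneg]
  have hp : HasProd (fun p : ℕ × ℕ => (1 + x p.1 * y p.2) / (1 - x p.1 * y p.2)) (Z x y) :=
    (hx.multipliable_Z hc hy).hasProd
  have hq : ∀ i, HasProd (fun j => (1 + x i * y j) / (1 - x i * y j)) (Q y (x i)) := fun i =>
    hy.hasProd_Q (mul_lt_one_of_le hy.nonneg (hx.bound i) hcc)
  exact (hp.prod_fiberwise hq).tendsto_prod_nat

/-! ### The contour integrals defining `L_x` -/

theorem Admissible.continuousOn_Q_sphere {c r : ℝ} {x : ℕ → ℂ} (hx : Admissible c x)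
    (hrc : r * c < 1) : ContinuousOn (Q x) (Metric.sphere 0 r) :=
  (hx.differentiableOn_Q_closedBall hrc).continuousOn.mono Metric.sphere_subset_closedBall

theorem Admissible.circleIntegral_Q_div_pow {c r : ℝ} {x : ℕ → ℂ} (hx : Admissible c x)
    (hr : 0 < r) (hrc : r * c < 1) (n : ℕ) :
    (∮ z in C(0, r), Q x z / z ^ (n + 1)) = 2 * π * Complex.I * qCoeff x n := by
  have h := (hx.differentiableOn_Q_closedBall hrc).circleIntegral_one_div_sub_center_pow_smul hr n
  simp only [sub_zero, smul_eq_mul, one_div_mul_eq_div] at h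
  rw [h, qCoeff]
  ring

theorem ne_zero_of_mem_sphere {r : ℝ} (hr : 0 < r) {z : ℂ} (hz : z ∈ Metric.sphere (0 : ℂ) r) :
    z ≠ 0 := by
  rintro rfl
  simp at hz
  exact hr.ne hz

theorem add_ne_zero_of_norm_lt {z w : ℂ} (h : ‖w‖ < ‖z‖) : z + w ≠ 0 := fun h0 => by
  rw [eq_neg_of_add_eq_zero_left h0, norm_neg] at h
  exact h.false

/-- Induction on `p` by `1 / (w^(p+1) (z + w)) = z⁻¹ (1 / w^(p+1) - 1 / (w^p (z + w)))`. For `p = 0`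
the integrand is holomorphic on the disc, the pole `-z` lying outside. -/
theorem Admissible.circleIntegral_inner {c s : ℝ} {x : ℕ → ℂ} (hx : Admissible c x)
    (hs : 0 < s) (hsc : s * c < 1) {z : ℂ} (hz : s < ‖z‖) (p : ℕ) :
    (∮ w in C(0, s), Q x w / w ^ p * (1 / (z + w))) =
      2 * π * Complex.I * ∑ m ∈ Finset.range p, (-1) ^ m * qCoeff x (p - 1 - m) / z ^ (m + 1) := by
  have hz0 : z ≠ 0 := norm_pos_iff.1 (hs.trans hz)
  induction p with
  | zero =>
    have hd : DifferentiableOn ℂ (fun w => Q x w / w ^ 0 * (1 / (z + w))) (Metric.closedBall 0 s) := by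
      simp only [pow_zero, div_one]
      refine (hx.differentiableOn_Q_closedBall hsc).mul (DifferentiableOn.div (by fun_prop)
        (by fun_prop) fun w hw => add_ne_zero_of_norm_lt ?_)
      exact (mem_closedBall_zero_iff.1 hw).trans_lt hz
    rw [(hd.diffContOnCl_ball subset_rfl).circleIntegral_eq_zero hs.le]
    simp
  | succ p ih =>
    have h1 : (∮ w in C(0, s), Q x w / w ^ (p + 1) * (1 / (z + w))) =
        ∮ w in C(0, s), z⁻¹ * (Q x w / w ^ (p + 1) - Q x w / w ^ p * (1 / (z + w))) := by
      refine circleIntegral.integral_congr hs.le fun w hw => ?_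
      have hw0 := ne_zero_of_mem_sphere hs hw
      have hzw : z + w ≠ 0 := add_ne_zero_of_norm_lt (by rwa [mem_sphere_zero_iff_norm.1 hw])
      field_simp
      ring
    have hc := hx.continuousOn_Q_sphere hsc
    have hp : ∀ p : ℕ, ContinuousOn (fun w => Q x w / w ^ p) (Metric.sphere 0 s) := fun p =>
      hc.div (by fun_prop) fun w hw => pow_ne_zero _ (ne_zero_of_mem_sphere hs hw)
    have hi : ContinuousOn (fun w => 1 / (z + w)) (Metric.sphere 0 s) :=
      ContinuousOn.div (by fun_prop) (by fun_prop) fun w hw =>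
        add_ne_zero_of_norm_lt (by rwa [mem_sphere_zero_iff_norm.1 hw])
    have hpi : ContinuousOn (fun w => Q x w / w ^ p * (1 / (z + w))) (Metric.sphere 0 s) :=
      (hp p).mul hi
    rw [h1, circleIntegral.integral_const_mul, circleIntegral.integral_sub
      ((hp (p + 1)).circleIntegrable hs.le) (hpi.circleIntegrable hs.le),
      hx.circleIntegral_Q_div_pow hs hsc, ih, Finset.sum_range_succ']
    have h2 : ∀ m, p - 1 - m = p - (m + 1) := fun m => by omega
    simp only [← mul_sub, pow_zero, Nat.sub_zero, Nat.add_sub_cancel, one_mul, zero_add, pow_one]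
    rw [mul_left_comm, mul_sub, Finset.mul_sum, sub_eq_add_neg, add_comm, ← Finset.sum_neg_distrib]
    congr 2
    · refine Finset.sum_congr rfl fun m _ => ?_
      rw [h2 m]
      field_simp
      ring
    · field_simp

theorem Admissible.LMatrix_eq_of_lt {c r s : ℝ} {x : ℕ → ℂ} (hx : Admissible c x)
    (hr : 0 < r) (hs : 0 < s) (hrc : r * c < 1) (hsc : s * c < 1) (hsr : s < r) (j k : ℕ) :
    LMatrix r s x j k =
      ∑ m ∈ Finset.range (k + 1), (-1) ^ m * qCoeff x (k - m) * qCoeff x (j + m + 1) := by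
  have hpi : (2 * π * Complex.I : ℂ) ≠ 0 := Complex.two_pi_I_ne_zero
  have h1 : (∮ z in C(0, r), ∮ ζ in C(0, s),
      Q x z * Q x ζ / (z ^ (j + 1) * ζ ^ (k + 1)) * (1 / (z + ζ))) =
      ∮ z in C(0, r), ∑ m ∈ Finset.range (k + 1),
        (2 * π * Complex.I * ((-1) ^ m * qCoeff x (k - m))) * (Q x z / z ^ (j + m + 1 + 1)) := by
    refine circleIntegral.integral_congr hr.le fun z hz => ?_
    have hz0 := ne_zero_of_mem_sphere hr hz
    have h2 := hx.circleIntegral_inner hs hsc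
      (show s < ‖z‖ by rwa [mem_sphere_zero_iff_norm.1 hz]) (k + 1)
    calc (∮ ζ in C(0, s), Q x z * Q x ζ / (z ^ (j + 1) * ζ ^ (k + 1)) * (1 / (z + ζ)))
        = ∮ ζ in C(0, s), (Q x z / z ^ (j + 1)) * (Q x ζ / ζ ^ (k + 1) * (1 / (z + ζ))) := by
          congr 1
          ext ζ
          rw [mul_div_mul_comm, mul_assoc]
      _ = _ := by
          rw [circleIntegral.integral_const_mul, h2, Finset.mul_sum, Finset.mul_sum]
          refine Finset.sum_congr rfl fun m _ => ?_
          rw [Nat.add_sub_cancel, add_right_comm j m 1, add_assoc (j + 1), pow_add z (j + 1)]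
          field_simp
  have hp : ∀ p : ℕ, ContinuousOn (fun w => Q x w / w ^ p) (Metric.sphere 0 r) := fun p =>
    (hx.continuousOn_Q_sphere hrc).div (by fun_prop)
      fun w hw => pow_ne_zero _ (ne_zero_of_mem_sphere hr hw)
  have hcp : ∀ (a : ℂ) (p : ℕ), CircleIntegrable (fun w => a * (Q x w / w ^ p)) 0 r := fun a p =>
    (continuousOn_const.mul (hp p)).circleIntegrable hr.le
  rw [LMatrix, h1, circleIntegral.integral_fun_sum fun m _ => hcp _ _]
  simp only [circleIntegral.integral_const_mul, hx.circleIntegral_Q_div_pow hr hrc]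
  rw [Finset.mul_sum]
  refine Finset.sum_congr rfl fun m _ => ?_
  field_simp

/-- Fubini; the integrand is continuous because `r ≠ s` keeps `z + ζ` away from zero. This reduces
the case `r < s` to `s < r`. -/
theorem Admissible.LMatrix_symm {c r s : ℝ} {x : ℕ → ℂ} (hx : Admissible c x)
    (hr : 0 < r) (hs : 0 < s) (hrc : r * c < 1) (hsc : s * c < 1) (hrs : r ≠ s) (j k : ℕ) :
    LMatrix r s x j k = LMatrix s r x k j := by
  unfold LMatrix circleIntegral
  simp only [← intervalIntegral.integral_smul]
  rw [MeasureTheory.intervalIntegral_intervalIntegral_swap]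
  · simp only [smul_eq_mul]
    congr 3
    ext θ
    congr 1
    ext φ
    rw [add_comm (circleMap 0 s θ), mul_comm (Q x (circleMap 0 s θ)),
      mul_comm (circleMap 0 s θ ^ _)]
    ring
  · have hcr : ∀ {ρ : ℝ}, 0 < ρ → ρ * c < 1 → Continuous fun θ => Q x (circleMap 0 ρ θ) :=
      fun h0 h => (hx.continuousOn_Q_sphere h).comp_continuous (continuous_circleMap _ _)
        (circleMap_mem_sphere _ h0.le)
    refine (Continuous.continuousOn ?_).integrableOn_compact (isCompact_uIcc.prod isCompact_uIcc)
      |>.mono_set (Set.prod_mono Set.uIoc_subset_uIcc Set.uIoc_subset_uIcc)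
    have h1 : ∀ {ρ : ℝ}, 0 < ρ → ∀ θ, circleMap 0 ρ θ ≠ 0 := fun h θ => circleMap_ne_center h.ne'
    have h2 : ∀ θ φ, circleMap 0 r θ + circleMap 0 s φ ≠ 0 := by
      intro θ φ h0
      have := congrArg norm (eq_neg_of_add_eq_zero_left h0)
      rw [norm_neg, norm_circleMap_zero, norm_circleMap_zero, abs_of_pos hr, abs_of_pos hs] at this
      exact hrs this
    simp only [Function.uncurry_def, deriv_circleMap, smul_eq_mul]
    have c1 := (hcr hr hrc).comp (continuous_fst (X := ℝ) (Y := ℝ))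
    have c2 := (hcr hs hsc).comp (continuous_snd (X := ℝ) (Y := ℝ))
    have c3 := (continuous_circleMap 0 r).comp (continuous_fst (X := ℝ) (Y := ℝ))
    have c4 := (continuous_circleMap 0 s).comp (continuous_snd (X := ℝ) (Y := ℝ))
    simp only [Function.comp_def] at c1 c2 c3 c4
    refine (c3.mul continuous_const).mul ((c4.mul continuous_const).mul (((c1.mul c2).div₀
      ((c3.pow _).mul (c4.pow _)) fun p => ?_).mul (continuous_const.div₀ (c3.add c4) fun p => ?_)))
    · exact mul_ne_zero (pow_ne_zero _ (h1 hr _)) (pow_ne_zero _ (h1 hs _))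
    · exact h2 _ _

/-! ### The operator `J` and the factorizations of `L_x` -/

theorem isBoundedMatrix_signMatrix : IsBoundedMatrix signMatrix :=
  diag_isBoundedMatrix (d := fun j => (-1) ^ j) fun j => by simp

theorem entry_J (j k : ℕ) : entry J j k = if j = k then (-1) ^ j else 0 :=
  hasMatrix_matrixOp isBoundedMatrix_signMatrix j k

theorem entry_mul_J (A : Op) (j k : ℕ) : entry (A * J) j k = entry A j k * (-1) ^ k := by
  rw [← (hasSum_entry_mul _ _ j k).tsum_eq, tsum_eq_single k fun i hi => by
    rw [entry_J, if_neg hi, mul_zero], entry_J, if_pos rfl]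

theorem entry_J_mul (A : Op) (j k : ℕ) : entry (J * A) j k = (-1) ^ j * entry A j k := by
  rw [← (hasSum_entry_mul _ _ j k).tsum_eq, tsum_eq_single j fun i hi => by
    rw [entry_J, if_neg hi.symm, zero_mul], entry_J, if_pos rfl]

theorem J_mul_J : J * J = 1 := by
  refine op_ext fun j k => ?_
  rw [entry_J_mul, entry_J, entry_one]
  split_ifs
  · rw [← mul_pow]; simp
  · rw [mul_zero]

theorem Admissible.symbolCoeff_Q_neg {c : ℝ} (hc : c < 1) {x : ℕ → ℂ} (hx : Admissible c x)
    (n : ℤ) : symbolCoeff (Q (-x)) n = (-1) ^ n * symbolCoeff (Q x) n := by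
  rcases lt_or_ge n 0 with hn | hn
  · rw [(hx.neg.isAnalyticWiener_Q hc).coeff_neg n hn, (hx.isAnalyticWiener_Q hc).coeff_neg n hn,
      mul_zero]
  · lift n to ℕ using hn
    rw [hx.neg.symbolCoeff_Q hc, hx.symbolCoeff_Q hc, qCoeff_neg, zpow_natCast]

theorem Admissible.Q_neg_mul_Q_circle {c : ℝ} (hc : c < 1) {x : ℕ → ℂ} (hx : Admissible c x)
    (z : ℂ) (hz : ‖z‖ = 1) : (Q (-x) * Q x) z = (1 : ℂ → ℂ) z := by
  rw [Pi.mul_apply, mul_comm]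
  exact hx.Q_mul_Q_neg (by rwa [hz, one_mul])

theorem Admissible.inv_Q_circle {c : ℝ} (hc : c < 1) {x : ℕ → ℂ} (hx : Admissible c x)
    (z : ℂ) (hz : ‖z‖ = 1) : (Q x)⁻¹ z = Q (-x) z :=
  hx.inv_Q (by rwa [hz, one_mul])

theorem Admissible.inv_tilde_Q_circle {c : ℝ} (hc : c < 1) {x : ℕ → ℂ} (hx : Admissible c x)
    (z : ℂ) (hz : ‖z‖ = 1) : (tilde (Q x))⁻¹ z = tilde (Q (-x)) z :=
  hx.inv_Q_circle hc z⁻¹ (by rw [norm_inv, hz, inv_one])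

/-- This is `H_mul` for the product `Q_{-x} Q_x = 1`, whose Hankel operator vanishes. -/
theorem Admissible.T_Q_neg_mul_H {c : ℝ} (hc : c < 1) {x : ℕ → ℂ} (hx : Admissible c x) :
    T (Q (-x)) * H (Q x) = -(H (Q (-x)) * T (tilde (Q x))) := by
  rw [eq_neg_iff_add_eq_zero, ← H_mul (hx.neg.isAnalyticWiener_Q hc).1 (hx.isAnalyticWiener_Q hc).1,
    H_congr (hx.Q_neg_mul_Q_circle hc), H_one]

/-- Conjugation by `J` corresponds to `z ↦ -z`, which exchanges `Q_x` and `Q_{-x}`; the minus sign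
comes from the shift by one in the Hankel index `j + k + 1`. -/
theorem Admissible.J_mul_H {c : ℝ} (hc : c < 1) {x : ℕ → ℂ} (hx : Admissible c x) :
    J * H (Q (-x)) = -(H (Q x) * J) := by
  refine op_ext fun j k => ?_
  rw [entry_J_mul, entry_neg, entry_mul_J, (hx.neg.isAnalyticWiener_Q hc).entry_H,
    (hx.isAnalyticWiener_Q hc).entry_H, hx.symbolCoeff_Q_neg hc]
  rw [show ((j : ℤ) + k + 1) = ((j + k + 1 : ℕ) : ℤ) by push_cast; rfl, zpow_natCast]
  have h : (-1 : ℂ) ^ j * (-1) ^ j = 1 := by rw [← mul_pow]; simp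
  linear_combination (-(-1) ^ k * symbolCoeff (Q x) ((j + k + 1 : ℕ) : ℤ)) * h

theorem Admissible.J_mul_T {c : ℝ} (hc : c < 1) {x : ℕ → ℂ} (hx : Admissible c x) :
    J * T (tilde (Q x)) = T (tilde (Q (-x))) * J := by
  have hw := hx.isAnalyticWiener_Q hc
  have hw' := hx.neg.isAnalyticWiener_Q hc
  refine op_ext fun j k => ?_
  rw [entry_J_mul, entry_mul_J, hw.tilde.entry_T, hw'.tilde.entry_T, hw.symbolCoeff_tilde,
    hw'.symbolCoeff_tilde, hx.symbolCoeff_Q_neg hc, neg_sub, zpow_sub₀ (by norm_num), zpow_natCast,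
    zpow_natCast]
  have h : (-1 : ℂ) ^ j * (-1) ^ j = 1 := by rw [← mul_pow]; simp
  have h' : (-1 : ℂ) ^ k * (-1) ^ k = 1 := by rw [← mul_pow]; simp
  rw [div_eq_mul_inv, inv_eq_of_mul_eq_one_right h]
  linear_combination -((-1) ^ j * symbolCoeff (Q x) (k - j)) * h'

/-- The two factorizations of `L_x` agree. -/
theorem Admissible.H_mul_T_mul_J {c : ℝ} (hc : c < 1) {x : ℕ → ℂ} (hx : Admissible c x) :
    H (Q x) * T (tilde (Q (-x))) * J = -(J * H (Q (-x)) * T (tilde (Q x))) := by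
  rw [hx.J_mul_H hc, neg_mul, neg_neg, mul_assoc, mul_assoc, hx.J_mul_T hc]

/-- Hankel matrices are symmetric and `T(ψ̃)` is the transpose of `T(ψ)`, so the transpose of
`H(Q_x) T(Q̃_{-x}) J` is `J T(Q_{-x}) H(Q_x)`, which is the other factorization. -/
theorem Admissible.entry_H_mul_T_mul_J_symm {c : ℝ} (hc : c < 1) {x : ℕ → ℂ}
    (hx : Admissible c x) (j k : ℕ) :
    entry (H (Q x) * T (tilde (Q (-x))) * J) j k = entry (H (Q x) * T (tilde (Q (-x))) * J) k j := by
  have hw := hx.isAnalyticWiener_Q hc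
  have hw' := hx.neg.isAnalyticWiener_Q hc
  have hM : H (Q x) * T (tilde (Q (-x))) * J = J * (T (Q (-x)) * H (Q x)) := by
    rw [hx.H_mul_T_mul_J hc, mul_assoc, ← mul_neg, ← hx.T_Q_neg_mul_H hc]
  conv_lhs => rw [hM]
  rw [entry_J_mul, entry_mul_J, mul_comm]
  congr 1
  refine (hasSum_entry_mul _ _ j k).unique ((hasSum_entry_mul _ _ k j).congr_fun fun n => ?_)
  rw [hw'.entry_T, hw.entry_H, hw.entry_H, hw'.tilde.entry_T, hw'.symbolCoeff_tilde, neg_sub,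
    mul_comm, add_comm (n : ℤ)]

theorem Admissible.entry_H_mul_T_mul_J {c : ℝ} (hc : c < 1) {x : ℕ → ℂ} (hx : Admissible c x)
    (j k : ℕ) : entry (H (Q x) * T (tilde (Q (-x))) * J) j k =
      ∑ m ∈ Finset.range (k + 1), (-1) ^ m * qCoeff x (k - m) * qCoeff x (j + m + 1) := by
  have hw := hx.isAnalyticWiener_Q hc
  have hw' := hx.neg.isAnalyticWiener_Q hc
  rw [entry_mul_J, ← (hasSum_entry_mul _ _ j k).tsum_eq,
    -- `T(Q̃_{-x})` is upper triangular, so only `m ≤ k` contributes.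
    tsum_eq_sum (s := Finset.range (k + 1)) fun m hm => ?_, Finset.sum_mul]
  · refine Finset.sum_congr rfl fun m hm => ?_
    obtain ⟨d, rfl⟩ := Nat.exists_eq_add_of_le (Finset.mem_range_succ_iff.1 hm)
    rw [hw.entry_H, hw'.tilde.entry_T, hw'.symbolCoeff_tilde,
      show -((m : ℤ) - ((m + d : ℕ) : ℤ)) = (d : ℕ) by push_cast; ring, Nat.add_sub_cancel_left,
      show ((j : ℤ) + m + 1) = ((j + m + 1 : ℕ) : ℤ) by push_cast; rfl,
      hx.symbolCoeff_Q hc, hx.neg.symbolCoeff_Q hc, qCoeff_neg]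
    have h : (-1 : ℂ) ^ d * (-1) ^ d = 1 := by rw [← mul_pow]; simp
    rw [pow_add]
    linear_combination ((-1) ^ m * qCoeff x d * qCoeff x (j + m + 1)) * h
  · rw [hw'.tilde.entry_T, hw'.symbolCoeff_tilde, hw'.coeff_neg _ (by
      rw [Finset.mem_range] at hm; omega), mul_zero]

theorem Admissible.hasMatrix_L {c r s : ℝ} (hc : c < 1) {x : ℕ → ℂ} (hx : Admissible c x)
    (hr : 0 < r) (hs : 0 < s) (hrs : r ≠ s) (hrc : r * c < 1) (hsc : s * c < 1) :
    HasMatrix (H (Q x) * T (tilde (Q (-x))) * J) (LMatrix r s x) := by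
  intro j k
  rcases lt_or_gt_of_ne hrs with h | h
  · rw [hx.LMatrix_symm hr hs hrc hsc hrs, hx.LMatrix_eq_of_lt hs hr hsc hrc h,
      hx.entry_H_mul_T_mul_J_symm hc, hx.entry_H_mul_T_mul_J hc]
  · rw [hx.LMatrix_eq_of_lt hr hs hrc hsc h, hx.entry_H_mul_T_mul_J hc]

/-! ### Geometric majorants and summable operators -/

theorem isSchur_toeplitz_of {α : ℤ → ℝ≥0∞} (h : ∑' n, α n ≠ ⊤) :
    IsSchur fun j k => α ((j : ℤ) - k) :=
  ⟨_, h, fun j => ENNReal.tsum_comp_le_tsum_of_injective (f := fun k : ℕ => (j : ℤ) - k)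
    (fun a b h => by simpa using h) α,
    fun k => ENNReal.tsum_comp_le_tsum_of_injective (f := fun j : ℕ => (j : ℤ) - k)
    (fun a b h => by simpa using h) α⟩

/-- The two-sided geometric sequence `M r^|n|`. -/
noncomputable def geomMaj (M r : ℝ) (n : ℤ) : ℝ≥0∞ := ENNReal.ofReal (M * r ^ n.natAbs)

theorem tsum_geomMaj_ne_top {M r : ℝ} (hr0 : 0 ≤ r) (hr : r < 1) : ∑' n, geomMaj M r n ≠ ⊤ := by
  have h : Summable fun n : ℤ => M * r ^ n.natAbs := by
    refine Summable.of_nat_of_neg ?_ ?_ <;>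
    simpa using (summable_geometric_of_lt_one hr0 hr).mul_left M
  exact h.tsum_ofReal_ne_top

theorem isSumm_hankel_geomMaj {M r : ℝ} (hM : 0 ≤ M) (hr0 : 0 ≤ r) (hr : r < 1) :
    IsSumm fun j k => geomMaj M r ((j : ℤ) + k + 1) := by
  have h : ∀ j k : ℕ, geomMaj M r ((j : ℤ) + k + 1) =
      ENNReal.ofReal (M * r) * (ENNReal.ofReal r ^ j * ENNReal.ofReal r ^ k) := by
    intro j k
    rw [geomMaj, show ((j : ℤ) + k + 1).natAbs = j + k + 1 by omega, ← ENNReal.ofReal_pow hr0,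
      ← ENNReal.ofReal_pow hr0, ← ENNReal.ofReal_mul (by positivity),
      ← ENNReal.ofReal_mul (by positivity)]
    congr 1
    ring
  have hg : (1 - ENNReal.ofReal r)⁻¹ ≠ ⊤ :=
    ENNReal.inv_ne_top.2 (tsub_pos_of_lt (by simpa using hr)).ne'
  unfold IsSumm
  simp only [h, ENNReal.tsum_mul_left, ENNReal.tsum_mul_right, ENNReal.tsum_geometric]
  exact ENNReal.mul_ne_top ENNReal.ofReal_ne_top (ENNReal.mul_ne_top hg hg)

/-- The constants depend on `c` and `S` alone, so a single majorant serves a sequence, its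
truncations and their negatives. -/
theorem exists_geomMaj {c : ℝ} (hc : c < 1) (S : ℝ) :
    ∃ M r : ℝ, 0 ≤ M ∧ 0 ≤ r ∧ r < 1 ∧ ∀ x', Admissible c x' → ∑' i, ‖x' i‖ ≤ S →
      ∀ n, ‖symbolCoeff (Q x') n‖ₑ ≤ geomMaj M r n := by
  obtain ⟨ρ, h1, hρ⟩ := exists_radius_gt (ρ := 1) (c := c) (by linarith)
  have hρ0 : 0 < ρ := by linarith
  refine ⟨QBound c ρ S, ρ⁻¹, (Real.exp_pos _).le, by positivity,
    inv_lt_one_of_one_lt₀ h1, fun x' hx' hS n => ?_⟩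
  rcases lt_or_ge n 0 with hn | hn
  · rw [(hx'.isAnalyticWiener_Q hc).coeff_neg n hn, enorm_zero]
    exact zero_le
  · lift n to ℕ using hn
    rw [hx'.symbolCoeff_Q hc, geomMaj, Int.natAbs_natCast, ← ofReal_norm]
    exact ENNReal.ofReal_le_ofReal (hx'.norm_qCoeff_le hρ hρ0 hS n)

theorem Admissible.isSumm_H {c : ℝ} (hc : c < 1) {x : ℕ → ℂ} (hx : Admissible c x) :
    IsSumm fun j k => ‖entry (H (Q x)) j k‖ₑ := by
  obtain ⟨M, r, hM, hr0, hr, h⟩ := exists_geomMaj hc (∑' i, ‖x i‖)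
  refine (isSumm_hankel_geomMaj hM hr0 hr).mono fun j k => ?_
  rw [(hx.isAnalyticWiener_Q hc).entry_H]
  exact h x hx le_rfl _

theorem IsWiener.isSchur_T {ψ : ℂ → ℂ} (hψ : IsWiener ψ) : IsSchur fun j k => ‖entry (T ψ) j k‖ₑ := by
  simp only [hψ.entry_T]
  exact hψ.isSchur_toeplitz

theorem IsWiener.isSchur_H {ψ : ℂ → ℂ} (hψ : IsWiener ψ) : IsSchur fun j k => ‖entry (H ψ) j k‖ₑ := by
  simp only [hψ.entry_H]
  exact hψ.isSchur_hankel

/-- Operators whose matrix has uniformly bounded absolute row and column sums. -/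
def SchurOp (A : Op) : Prop := IsSchur fun j k => ‖entry A j k‖ₑ

/-- Operators whose matrix is absolutely summable. -/
def SummOp (A : Op) : Prop := IsSumm fun j k => ‖entry A j k‖ₑ

theorem SummOp.mul_right {A B : Op} (h : SummOp A) (h' : SchurOp B) : SummOp (A * B) :=
  (IsSumm.mprod_right h h').mono (enorm_entry_mul_le (fun _ _ => le_rfl) fun _ _ => le_rfl)

theorem SummOp.mul_left {A B : Op} (h : SchurOp A) (h' : SummOp B) : SummOp (A * B) :=
  (IsSumm.mprod_left h h').mono (enorm_entry_mul_le (fun _ _ => le_rfl) fun _ _ => le_rfl)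

theorem SummOp.neg {A : Op} (h : SummOp A) : SummOp (-A) := by
  simpa only [SummOp, entry_neg, enorm_neg] using h

theorem SummOp.isTraceClass {A : Op} (h : SummOp A) : IsTraceClass A :=
  isTraceClass_of_isSumm (fun _ _ => le_rfl) h

theorem SummOp.fredholmDet_mul {K M : Op} (hK : SummOp K) (hM : SummOp M) :
    fredholmDet ((1 + K) * (1 + M)) = fredholmDet (1 + K) * fredholmDet (1 + M) :=
  ShiftedSchur.fredholmDet_mul (fun _ _ => le_rfl) (fun _ _ => le_rfl) hK hM

theorem SummOp.fredholmDet_comm {A B : Op} (hA : SummOp A) (hB : SchurOp B) :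
    fredholmDet (1 + A * B) = fredholmDet (1 + B * A) :=
  fredholmDet_mul_comm (fun _ _ => le_rfl) (fun _ _ => le_rfl) hA hB

/-! ### Determinants of Toeplitz commutators -/

/-- Multiplicativity of the determinant of a commutator `A U A⁻¹ U⁻¹` in `U`. -/
theorem fredholmDet_commutator_mul {A A' U U' V V' : Op} (hA : A' * A = 1) (hU : U' * U = 1)
    (hU1 : U * U' = 1) (sU : SchurOp U) (sU' : SchurOp U') (hK : SummOp (A * U * A' * U' - 1))
    (hM : SummOp (A * V * A' * V' - 1)) :
    fredholmDet (A * (U * V) * A' * (V' * U')) =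
      fredholmDet (A * U * A' * U') * fredholmDet (A * V * A' * V') := by
  obtain ⟨K, hK'⟩ : ∃ K, A * U * A' * U' = 1 + K := ⟨_, (add_sub_cancel _ _).symm⟩
  obtain ⟨M, hM'⟩ : ∃ M, A * V * A' * V' = 1 + M := ⟨_, (add_sub_cancel _ _).symm⟩
  rw [hK', add_sub_cancel_left] at hK
  rw [hM', add_sub_cancel_left] at hM
  -- Inserting `A' U' U A = 1` splits off the commutator of `U`, leaving that of `V` conjugated by
  -- `U`; the conjugation is then removed by cyclicity.
  have e : A * (U * V) * A' * (V' * U') = (1 + K) * (1 + U * M * U') := by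
    have e1 : (1 : Op) + U * M * U' = U * (1 + M) * U' := by
      rw [mul_add, add_mul, mul_one, hU1]
    rw [e1, ← hK', ← hM']
    calc A * (U * V) * A' * (V' * U') = A * U * V * A' * V' * U' := by simp only [mul_assoc]
      _ = A * U * (A' * (U' * U) * A) * V * A' * V' * U' := by rw [hU, mul_one, hA, mul_one]
      _ = _ := by simp only [mul_assoc]
  rw [e, hK', hM', hK.fredholmDet_mul ((SummOp.mul_left sU hM).mul_right sU'),
    (SummOp.mul_left sU hM).fredholmDet_comm sU', ← mul_assoc, hU, one_mul]

/-- `T(Q̃_y) T(β) = T(β) T(Q̃_y) + H(β) H(Q_y)` for analytic `β`. -/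
theorem Admissible.T_tilde_mul_T {c : ℝ} (hc : c < 1) {y : ℕ → ℂ} (hy : Admissible c y)
    {β : ℂ → ℂ} (hβ : IsAnalyticWiener β) :
    T (tilde (Q y)) * T β = T β * T (tilde (Q y)) + H β * H (Q y) := by
  have hw := hy.isAnalyticWiener_Q hc
  rw [← T_tilde_mul hw hβ.1, mul_comm, T_mul hβ.1 hw.tilde, tilde_tilde]

theorem T_mul_T_eq_one {β β' : ℂ → ℂ} (hβ : IsWiener β) (hβ' : IsAnalyticWiener β')
    (h : ∀ z, ‖z‖ = 1 → β z * β' z = 1) : T β * T β' = 1 := by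
  rw [← T_mul_analytic hβ hβ', T_congr (ψ := β * β') (χ := 1) h, T_one]

theorem T_tilde_mul_T_tilde_eq_one {β β' : ℂ → ℂ} (hβ : IsAnalyticWiener β) (hβ' : IsWiener β')
    (h : ∀ z, ‖z‖ = 1 → β z * β' z = 1) : T (tilde β) * T (tilde β') = 1 := by
  rw [← T_tilde_mul hβ hβ'.tilde, T_congr (χ := 1), T_one]
  exact fun z hz => h _ (by rw [norm_inv, hz, inv_one])

theorem Admissible.Q_mul_Q_neg_circle {c : ℝ} (hc : c < 1) {x : ℕ → ℂ} (hx : Admissible c x)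
    (z : ℂ) (hz : ‖z‖ = 1) : Q x z * Q (-x) z = 1 :=
  hx.Q_mul_Q_neg (by rwa [hz, one_mul])

theorem Admissible.T_tilde_mul_T_tilde_neg {c : ℝ} (hc : c < 1) {y : ℕ → ℂ}
    (hy : Admissible c y) : T (tilde (Q y)) * T (tilde (Q (-y))) = 1 :=
  T_tilde_mul_T_tilde_eq_one (hy.isAnalyticWiener_Q hc) (hy.neg.isAnalyticWiener_Q hc).1
    (hy.Q_mul_Q_neg_circle hc)

theorem Admissible.T_tilde_neg_mul_T_tilde {c : ℝ} (hc : c < 1) {y : ℕ → ℂ}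
    (hy : Admissible c y) : T (tilde (Q (-y))) * T (tilde (Q y)) = 1 := by
  simpa using hy.neg.T_tilde_mul_T_tilde_neg hc

theorem Admissible.T_mul_T_neg {c : ℝ} (hc : c < 1) {y : ℕ → ℂ} (hy : Admissible c y) :
    T (Q y) * T (Q (-y)) = 1 :=
  T_mul_T_eq_one (hy.isAnalyticWiener_Q hc).1 (hy.neg.isAnalyticWiener_Q hc)
    (hy.Q_mul_Q_neg_circle hc)

/-- `T(Q̃_y) T(β) T(Q̃_y)⁻¹ T(β)⁻¹ = I + H(β) H(Q_y) T(Q̃_y)⁻¹ T(β)⁻¹`. -/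
theorem Admissible.commutator_eq {c : ℝ} (hc : c < 1) {y : ℕ → ℂ} (hy : Admissible c y)
    {β β' : ℂ → ℂ} (hβ : IsAnalyticWiener β) (hβ' : IsAnalyticWiener β')
    (h : ∀ z, ‖z‖ = 1 → β z * β' z = 1) :
    T (tilde (Q y)) * T β * T (tilde (Q (-y))) * T β' =
      1 + H β * H (Q y) * T (tilde (Q (-y))) * T β' := by
  rw [hy.T_tilde_mul_T hc hβ, add_mul, add_mul, mul_assoc (T β), hy.T_tilde_mul_T_tilde_neg hc,
    mul_one, T_mul_T_eq_one hβ.1 hβ' h]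

theorem Admissible.summOp_commutator {c : ℝ} (hc : c < 1) {y : ℕ → ℂ} (hy : Admissible c y)
    {β β' : ℂ → ℂ} (hβ : IsAnalyticWiener β) (hβ' : IsAnalyticWiener β') :
    SummOp (H β * H (Q y) * T (tilde (Q (-y))) * T β') :=
  ((SummOp.mul_left hβ.isSchur_H (hy.isSumm_H hc)).mul_right
    (hy.neg.isAnalyticWiener_Q hc).tilde.isSchur_T).mul_right hβ'.isSchur_T

/-- Brings a lower triangular Toeplitz factor with unit diagonal to the left, where its first row is
trivial. -/
theorem Admissible.H_mul_T_tilde_neg {c : ℝ} (hc : c < 1) {y : ℕ → ℂ} (hy : Admissible c y) :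
    H (Q y) * T (tilde (Q (-y))) = -(T (Q y) * H (Q (-y))) := by
  have := hy.neg.T_Q_neg_mul_H hc
  rw [neg_neg] at this
  rw [this, neg_neg]

theorem isAnalyticWiener_one_sub (a : ℂ) : IsAnalyticWiener (fun z => 1 - z * a) ∧
    ∀ n : ℕ, symbolCoeff (fun z => 1 - z * a) n = if n = 0 then 1 else if n = 1 then -a else 0 := by
  have hs : ∀ n ∉ Finset.range 2, (if n = 0 then 1 else if n = 1 then -a else 0 : ℂ) = 0 := by
    intro n hn
    rw [Finset.mem_range] at hn
    rw [if_neg (by omega), if_neg (by omega)]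
  refine IsAnalyticWiener.of_hasSum ?_ fun z _ => ?_
  · exact summable_of_ne_finset_zero (s := Finset.range 2) fun n hn => by rw [hs n hn, norm_zero]
  · convert hasSum_sum_of_ne_finset_zero (s := Finset.range 2) fun n hn => ?_ using 1
    · simp [Finset.sum_range_succ, sub_eq_add_neg, mul_comm]
    · rw [hs n hn, zero_mul]
    · infer_instance

theorem isAnalyticWiener_inv_one_sub {a : ℂ} (ha : ‖a‖ < 1) :
    IsAnalyticWiener (fun z => (1 - z * a)⁻¹) ∧
    ∀ n : ℕ, symbolCoeff (fun z => (1 - z * a)⁻¹) n = a ^ n := by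
  refine IsAnalyticWiener.of_hasSum ?_ fun z hz => ?_
  · simpa only [norm_pow] using summable_geometric_of_lt_one (norm_nonneg a) ha
  · simp only [mul_comm (a ^ _), ← mul_pow]
    exact hasSum_geometric_of_norm_lt_one (by rwa [norm_mul, hz, one_mul])

theorem one_sub_mul_inv {a : ℂ} (ha : ‖a‖ < 1) (z : ℂ) (hz : ‖z‖ = 1) :
    (1 - z * a) * (1 - z * a)⁻¹ = 1 :=
  mul_inv_cancel₀ (one_sub_mul_ne_zero (by rwa [hz, one_mul]) le_rfl)

theorem qCoeff_zero (x : ℕ → ℂ) : qCoeff x 0 = 1 := by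
  simp [qCoeff, Q]

/-- The commutator of `T(Q̃_y)` and `T(1 - az)` has determinant `1 / Q_y(a)`. -/
theorem Admissible.fredholmDet_commutator_linear {c : ℝ} (hc : c < 1) {y : ℕ → ℂ}
    (hy : Admissible c y) {a : ℂ} (ha : ‖a‖ < 1) :
    fredholmDet (T (tilde (Q y)) * T (fun z => 1 - z * a) * T (tilde (Q (-y))) *
      T (fun z => (1 - z * a)⁻¹)) = Q (-y) a := by
  obtain ⟨hβ, hβc⟩ := isAnalyticWiener_one_sub a
  obtain ⟨hβ', hβc'⟩ := isAnalyticWiener_inv_one_sub ha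
  have hw := hy.isAnalyticWiener_Q hc
  have hw' := hy.neg.isAnalyticWiener_Q hc
  -- The Hankel matrix of a linear symbol has a single nonzero entry, so the perturbation lives in
  -- the first row and only its corner entry is needed.
  have hH : ∀ j k : ℕ, entry (H fun z => 1 - z * a) j k = if j = 0 ∧ k = 0 then -a else 0 := by
    intro j k
    rw [hβ.entry_H, show ((j : ℤ) + k + 1) = ((j + k + 1 : ℕ) : ℤ) by push_cast; rfl, hβc,
      if_neg (by omega)]
    refine if_congr (by omega) rfl rfl
  have hrow : ∀ (B : Op) (j k : ℕ), entry ((H fun z => 1 - z * a) * B) j k =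
      if j = 0 then -a * entry B 0 k else 0 := by
    intro B j k
    rw [← (hasSum_entry_mul _ _ j k).tsum_eq, tsum_eq_single 0 fun n hn => by
      rw [hH, if_neg (by tauto), zero_mul], hH]
    by_cases hj : j = 0 <;> simp [hj]
  have hTrow : ∀ B : Op, entry (T (Q y) * B) 0 0 = entry B 0 0 := by
    intro B
    rw [← (hasSum_entry_mul _ _ 0 0).tsum_eq, tsum_eq_single 0 fun n hn => by
      rw [hw.entry_T, hw.coeff_neg _ (by omega), zero_mul], hw.entry_T]
    rw [show (((0 : ℕ) : ℤ) - ((0 : ℕ) : ℤ)) = ((0 : ℕ) : ℤ) by simp, hy.symbolCoeff_Q hc,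
      qCoeff_zero, one_mul]
  -- The first column of `T((1 - az)⁻¹)` is `(aⁿ)`, so this is the Taylor series of `Q_{-y}` at `a`
  -- without its constant term.
  have hval : a * entry (H (Q (-y)) * T fun z => (1 - z * a)⁻¹) 0 0 = Q (-y) a - 1 := by
    have h1 := (hasSum_entry_mul (H (Q (-y))) (T fun z => (1 - z * a)⁻¹) 0 0).mul_left a
    have h2 := hy.neg.hasSum_qCoeff (z := a)
      (mul_lt_one_of_le hy.nonneg ha.le (by linarith))
    rw [← hasSum_nat_add_iff' 1] at h2
    simp only [Finset.sum_range_one, qCoeff_zero, pow_zero, mul_one] at h2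
    refine h1.unique (h2.congr_fun fun n => ?_)
    rw [hw'.entry_H, hβ'.entry_T,
      show (((0 : ℕ) : ℤ) + n + 1) = ((n + 1 : ℕ) : ℤ) by push_cast; ring,
      show ((n : ℤ) - ((0 : ℕ) : ℤ)) = (n : ℕ) by simp, hβc', hy.neg.symbolCoeff_Q hc, pow_succ]
    ring
  rw [hy.commutator_eq hc hβ hβ' (one_sub_mul_inv ha), mul_assoc (H _) (H _),
    hy.H_mul_T_tilde_neg hc, mul_assoc, fredholmDet_of_first_row, hrow, if_pos rfl, neg_mul,
    neg_mul, entry_neg, mul_assoc (T _), hTrow, mul_neg, neg_neg, hval]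
  · ring
  · intro j k hj
    rw [hrow, if_neg hj]

theorem truncSeq_neg (N : ℕ) (x : ℕ → ℂ) : truncSeq N (-x) = -truncSeq N x := by
  ext i
  by_cases h : i < N <;> simp [truncSeq, h]

theorem Admissible.Q_truncSeq_succ {c : ℝ} {x : ℕ → ℂ} (hx : Admissible c x)
    (N : ℕ) {z : ℂ} (hz : ‖z‖ * c < 1) :
    Q (ShiftedSchur.truncSeq (N + 1) x) z * (1 - z * x N) =
      Q (ShiftedSchur.truncSeq N x) z * (1 - z * -x N) := by
  rw [Q_truncSeq, Q_truncSeq, Finset.prod_range_succ, mul_assoc,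
    div_mul_cancel₀ _ (one_sub_mul_ne_zero hz (hx.bound N)), mul_neg, sub_neg_eq_add]

/-! ### Evaluation of the commutator determinant -/

/-- The determinant of the commutator of `T(Q̃_y)` and `T(Q_x)`. -/
noncomputable def commDet (x y : ℕ → ℂ) : ℂ :=
  fredholmDet (T (tilde (Q y)) * T (Q x) * T (tilde (Q (-y))) * T (Q (-x)))

/-- Clearing the denominator of the new factor gives one operator, written both as `T(Q_{x1}) T(1 -
z x_N)` and as `T(Q_{x0}) T(1 + z x_N)`. Comparing determinants gives `commDet x1 y * Q_{-y}(x_N) =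
commDet x0 y * Q_{-y}(-x_N)`, and both `1 / Q_{-y}(x_N)` and `Q_{-y}(-x_N)` equal `Q_y(x_N)`. -/
theorem Admissible.commDet_truncSeq_succ {c : ℝ} (hc : c < 1) {x y : ℕ → ℂ}
    (hx : Admissible c x) (hy : Admissible c y) (N : ℕ) :
    commDet (ShiftedSchur.truncSeq (N + 1) x) y =
      commDet (ShiftedSchur.truncSeq N x) y * Q y (x N) ^ 2 := by
  have ha : ‖x N‖ < 1 := (hx.bound N).trans_lt hc
  have ha' : ‖-x N‖ < 1 := by rwa [norm_neg]
  have h1 := hx.truncSeq (N + 1)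
  have h0 := hx.truncSeq N
  set x1 := ShiftedSchur.truncSeq (N + 1) x with hx1
  set x0 := ShiftedSchur.truncSeq N x with hx0
  have w1 := h1.isAnalyticWiener_Q hc
  have w1' := h1.neg.isAnalyticWiener_Q hc
  have w0 := h0.isAnalyticWiener_Q hc
  have w0' := h0.neg.isAnalyticWiener_Q hc
  have lin := fun a : ℂ => (isAnalyticWiener_one_sub a).1
  have inv := fun {a : ℂ} (ha : ‖a‖ < 1) => (isAnalyticWiener_inv_one_sub ha).1
  have hA := hy.T_tilde_neg_mul_T_tilde hc
  have hl : ∀ {a : ℂ}, ‖a‖ < 1 → T (fun z => 1 - z * a) * T (fun z => (1 - z * a)⁻¹) = 1 :=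
    fun ha => T_mul_T_eq_one (lin _).1 (inv ha) (one_sub_mul_inv ha)
  have hl' : ∀ {a : ℂ}, ‖a‖ < 1 → T (fun z => (1 - z * a)⁻¹) * T (fun z => 1 - z * a) = 1 :=
    fun ha => T_mul_T_eq_one (inv ha).1 (lin _) fun z hz => by
      rw [mul_comm]; exact one_sub_mul_inv ha z hz
  have key : ∀ {x' : ℕ → ℂ} (h' : Admissible c x') {a : ℂ} (ha : ‖a‖ < 1),
      fredholmDet (T (tilde (Q y)) * (T (Q x') * T fun z => 1 - z * a) * T (tilde (Q (-y))) *
        ((T fun z => (1 - z * a)⁻¹) * T (Q (-x')))) = commDet x' y * Q (-y) a := by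
    intro x' h' a ha
    have w := h'.isAnalyticWiener_Q hc
    have w' := h'.neg.isAnalyticWiener_Q hc
    rw [fredholmDet_commutator_mul hA (by simpa using h'.neg.T_mul_T_neg hc) (h'.T_mul_T_neg hc)
      w.isSchur_T w'.isSchur_T, hy.fredholmDet_commutator_linear hc ha, commDet]
    · rw [hy.commutator_eq hc w w' (h'.Q_mul_Q_neg_circle hc), add_sub_cancel_left]
      exact hy.summOp_commutator hc w w'
    · rw [hy.commutator_eq hc (lin _) (inv ha) (one_sub_mul_inv ha), add_sub_cancel_left]
      exact hy.summOp_commutator hc (lin _) (inv ha)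
  have hT : T (Q x1) * T (fun z => 1 - z * x N) = T (Q x0) * T (fun z => 1 - z * -x N) := by
    rw [← T_mul_analytic w1.1 (lin _), ← T_mul_analytic w0.1 (lin _)]
    exact T_congr fun z hz => hx.Q_truncSeq_succ N (by rwa [hz, one_mul])
  have hT' : T (fun z => (1 - z * x N)⁻¹) * T (Q (-x1)) =
      T (fun z => (1 - z * -x N)⁻¹) * T (Q (-x0)) := by
    -- Both sides are inverses of the common operator in `hT`.
    refine left_inv_eq_right_inv (a := T (Q x1) * T (fun z => 1 - z * x N)) ?_ ?_
    · rw [mul_assoc, ← mul_assoc (T (Q (-x1))), show T (Q (-x1)) * T (Q x1) = 1 by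
        simpa using h1.neg.T_mul_T_neg hc, one_mul, hl' ha]
    · rw [hT, mul_assoc, ← mul_assoc (T fun z => 1 - z * -x N), hl ha', one_mul,
        h0.T_mul_T_neg hc]
  have e := key h1 ha
  rw [hT, hT', key h0 ha', Q_neg_apply, neg_neg, Q_neg_apply] at e
  have hq := hy.Q_mul_Q_neg (z := x N) (mul_lt_one_of_le hy.nonneg ha.le (by linarith))
  rw [Q_neg_apply] at hq
  linear_combination (-Q y (x N)) * e - commDet x1 y * hq

theorem commDet_truncSeq_zero {c : ℝ} (hc : c < 1) {x y : ℕ → ℂ} (hx : Admissible c x)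
    (hy : Admissible c y) : commDet (truncSeq 0 x) y = 1 := by
  have h0 := hx.truncSeq 0
  have w := h0.isAnalyticWiener_Q hc
  have hH : H (Q (truncSeq 0 x)) = 0 := by
    rw [H_congr (χ := 1) (fun z _ => by rw [Q_truncSeq]; simp), H_one]
  rw [commDet, hy.commutator_eq hc w (h0.neg.isAnalyticWiener_Q hc) (h0.Q_mul_Q_neg_circle hc), hH,
    zero_mul, zero_mul, zero_mul, fredholmDet_of_first_row fun _ _ _ => rfl, entry_zero, add_zero]

theorem Admissible.commDet_truncSeq {c : ℝ} (hc : c < 1) {x y : ℕ → ℂ} (hx : Admissible c x)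
    (hy : Admissible c y) (N : ℕ) :
    commDet (ShiftedSchur.truncSeq N x) y = (∏ i ∈ Finset.range N, Q y (x i)) ^ 2 := by
  induction N with
  | zero => rw [commDet_truncSeq_zero hc hx hy]; simp
  | succ N ih => rw [hx.commDet_truncSeq_succ hc hy, ih, Finset.prod_range_succ, mul_pow]

/-- In the form `I + H(Q_x) H(Q_y) T(Q̃_{-y}) T(Q_{-x})` only the outer factors vary with `N`. The
Hankel one has a summable geometric majorant and the Toeplitz one a Schur majorant, both independent
of `N`. -/
theorem Admissible.tendsto_commDet {c : ℝ} (hc : c < 1) {x y : ℕ → ℂ} (hx : Admissible c x)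
    (hy : Admissible c y) :
    Tendsto (fun N => commDet (ShiftedSchur.truncSeq N x) y) atTop (𝓝 (commDet x y)) := by
  have hxN := hx.truncSeq
  have heq : ∀ {x'}, Admissible c x' → commDet x' y =
      fredholmDet (1 + H (Q x') * H (Q y) * T (tilde (Q (-y))) * T (Q (-x'))) := fun h' => by
    rw [commDet, hy.commutator_eq hc (h'.isAnalyticWiener_Q hc) (h'.neg.isAnalyticWiener_Q hc)
      (h'.Q_mul_Q_neg_circle hc)]
  simp only [heq hx, fun N => heq (hxN N)]
  obtain ⟨M, r, hM, hr0, hr, hmaj⟩ := exists_geomMaj hc (∑' i, ‖x i‖)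
  have hneg : ∀ N, ∑' i, ‖(-ShiftedSchur.truncSeq N x) i‖ ≤ ∑' i, ‖x i‖ := fun N => by
    simpa only [Pi.neg_apply, norm_neg] using hx.tsum_truncSeq_le N
  have d1 : DomTendsto (fun N => H (Q (ShiftedSchur.truncSeq N x))) (H (Q x))
      (fun j k => geomMaj M r ((j : ℤ) + k + 1)) := by
    refine ⟨fun N j k => ?_, fun j k => ?_⟩
    · rw [((hxN N).isAnalyticWiener_Q hc).entry_H]
      exact hmaj _ (hxN N) (hx.tsum_truncSeq_le N) _
    · simp only [fun N => ((hxN N).isAnalyticWiener_Q hc).entry_H,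
        (hx.isAnalyticWiener_Q hc).entry_H]
      exact hx.tendsto_symbolCoeff_truncSeq hc _
  have d2 : DomTendsto (fun N => T (Q (-ShiftedSchur.truncSeq N x))) (T (Q (-x)))
      (fun j k => geomMaj M r ((j : ℤ) - k)) := by
    refine ⟨fun N j k => ?_, fun j k => ?_⟩
    · rw [((hxN N).neg.isAnalyticWiener_Q hc).entry_T]
      exact hmaj _ (hxN N).neg (hneg N) _
    · simp only [fun N => ((hxN N).neg.isAnalyticWiener_Q hc).entry_T,
        (hx.neg.isAnalyticWiener_Q hc).entry_T]
      simpa only [truncSeq_neg] using hx.neg.tendsto_symbolCoeff_truncSeq hc ((j : ℤ) - k)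
  have s1 := isSumm_hankel_geomMaj hM hr0 hr
  have s2 := isSchur_toeplitz_of (tsum_geomMaj_ne_top (M := M) hr0 hr)
  have s3 : SchurOp (H (Q y)) := (hy.isAnalyticWiener_Q hc).isSchur_H
  have s4 : SchurOp (T (tilde (Q (-y)))) := (hy.neg.isAnalyticWiener_Q hc).tilde.isSchur_T
  exact tendsto_fredholmDet (((d1.mul (.const fun _ _ => le_rfl) s1.isSchur s3).mul
    (.const fun _ _ => le_rfl) (s1.isSchur.mprod s3) s4).mul d2
    ((s1.isSchur.mprod s3).mprod s4) s2) (((s1.mprod_right s3).mprod_right s4).mprod_right s2)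

theorem Admissible.commDet_eq {c : ℝ} (hc : c < 1) {x y : ℕ → ℂ} (hx : Admissible c x)
    (hy : Admissible c y) : commDet x y = Z x y ^ 2 := by
  refine tendsto_nhds_unique (hx.tendsto_commDet hc hy) ?_
  simp only [hx.commDet_truncSeq hc hy]
  exact (hx.tendsto_Z hc hy).pow 2

/-! ### Reduction of `det(I + L_x L_y)` to the commutator -/

/-- `L_x L_y = -H(Q_x) T(Q̃_x⁻¹) H(Q_y⁻¹) T(Q̃_y)`. -/
theorem Admissible.L_mul_L {c : ℝ} (hc : c < 1) {x y : ℕ → ℂ} (hy : Admissible c y) :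
    H (Q x) * T (tilde (Q (-x))) * J * (H (Q y) * T (tilde (Q (-y))) * J) =
      -(H (Q x) * T (tilde (Q (-x))) * H (Q (-y))) * T (tilde (Q y)) := by
  rw [hy.H_mul_T_mul_J hc, mul_assoc J, mul_neg, mul_assoc _ J, ← mul_assoc J J, J_mul_J, one_mul,
    neg_mul, mul_assoc _ (H (Q (-y)))]

theorem Admissible.summOp_L_mul_L {c : ℝ} (hc : c < 1) {x y : ℕ → ℂ} (hx : Admissible c x)
    (hy : Admissible c y) : SummOp (-(H (Q x) * T (tilde (Q (-x))) * H (Q (-y)))) :=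
  ((SummOp.mul_right (hx.isSumm_H hc) (hx.neg.isAnalyticWiener_Q hc).tilde.isSchur_T).mul_right
    (hy.neg.isAnalyticWiener_Q hc).isSchur_H).neg

/-- After `T(Q̃_y)` is moved to the front, each product of a Toeplitz operator with symbol `ψ̃` and
a Hankel operator with symbol `χ` is rewritten by `T(ψ̃)H(χ) = H(ψ̃χ) = H(χ)T(ψ)`. -/
theorem Admissible.fredholmDet_L_mul_L {c : ℝ} (hc : c < 1) {x y : ℕ → ℂ} (hx : Admissible c x)
    (hy : Admissible c y) :
    fredholmDet (1 + H (Q x) * T (tilde (Q (-x))) * J * (H (Q y) * T (tilde (Q (-y))) * J)) =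
      commDet x y := by
  have wx := hx.isAnalyticWiener_Q hc
  have wx' := hx.neg.isAnalyticWiener_Q hc
  have wy := hy.isAnalyticWiener_Q hc
  have wy' := hy.neg.isAnalyticWiener_Q hc
  rw [hy.L_mul_L hc, (hx.summOp_L_mul_L hc hy).fredholmDet_comm wy.tilde.isSchur_T, commDet,
    hy.commutator_eq hc wx wx' (hx.Q_mul_Q_neg_circle hc), mul_assoc (H (Q x)) (H (Q y)),
    hy.H_mul_T_tilde_neg hc]
  have e1 : T (tilde (Q y)) * H (Q x) = H (Q x) * T (Q y) := by
    rw [← H_tilde_mul wy wx.1, mul_comm, H_mul_tilde wx.1 wy]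
  have e2 : T (tilde (Q (-x))) * H (Q (-y)) = H (Q (-y)) * T (Q (-x)) := by
    rw [← H_tilde_mul wx' wy'.1, mul_comm, H_mul_tilde wy'.1 wx']
  congr 2
  rw [mul_neg, mul_neg, neg_mul, mul_assoc (H (Q x)), e2, ← mul_assoc, e1]
  simp only [mul_assoc]

theorem Admissible.T_phi {c : ℝ} (hc : c < 1) {x y : ℕ → ℂ} (hx : Admissible c x)
    (hy : Admissible c y) : IsWiener (phi x y) ∧ T (phi x y) = T (tilde (Q y)) * T (Q x) := by
  have wx := hx.isAnalyticWiener_Q hc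
  have wy := hy.isAnalyticWiener_Q hc
  have e : phi x y = tilde (Q y) * Q x := funext fun z => mul_comm _ _
  rw [e]
  exact ⟨wy.tilde.mul wx.1, T_tilde_mul wy wx.1⟩

theorem Admissible.inv_phi_circle {c : ℝ} (hc : c < 1) {x y : ℕ → ℂ} (hx : Admissible c x)
    (hy : Admissible c y) (z : ℂ) (hz : ‖z‖ = 1) : phi (-x) (-y) z = (phi x y)⁻¹ z := by
  have h1 := hx.inv_Q_circle hc z hz
  have h2 := hy.inv_tilde_Q_circle hc z hz
  rw [Pi.inv_apply] at h1 h2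
  rw [Pi.inv_apply, phi, phi, ← h1, ← h2, mul_inv]

end ShiftedSchur

/-! ### The main theorem -/

theorem mainTheorem4 (c : ℝ) (hc : c < 1)
    (r s : ℝ) (hr : 0 < r) (hs : 0 < s) (hrs : r ≠ s) (hrc : r * c < 1) (hsc : s * c < 1) :
    (∀ x : ℕ → ℂ, Summable (fun i => ‖x i‖) → (∀ i, ‖x i‖ ≤ c) →
      ShiftedSchur.IsBoundedMatrix (ShiftedSchur.LMatrix r s x) ∧
      ShiftedSchur.IsBoundedMatrix (ShiftedSchur.hankelMatrix (ShiftedSchur.Q x)) ∧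
      ShiftedSchur.IsBoundedMatrix (ShiftedSchur.hankelMatrix (ShiftedSchur.Q x)⁻¹) ∧
      ShiftedSchur.IsBoundedMatrix
        (ShiftedSchur.toeplitzMatrix (ShiftedSchur.tilde (ShiftedSchur.Q x))) ∧
      ShiftedSchur.IsBoundedMatrix
        (ShiftedSchur.toeplitzMatrix (ShiftedSchur.tilde (ShiftedSchur.Q x))⁻¹) ∧
      ShiftedSchur.IsBoundedMatrix ShiftedSchur.signMatrix ∧
      ShiftedSchur.L r s x =
        ShiftedSchur.H (ShiftedSchur.Q x) *
          ShiftedSchur.T (ShiftedSchur.tilde (ShiftedSchur.Q x))⁻¹ * ShiftedSchur.J ∧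
      ShiftedSchur.L r s x =
        -(ShiftedSchur.J * ShiftedSchur.H (ShiftedSchur.Q x)⁻¹ *
          ShiftedSchur.T (ShiftedSchur.tilde (ShiftedSchur.Q x)))) ∧
    (∀ x y : ℕ → ℂ, Summable (fun i => ‖x i‖) → (∀ i, ‖x i‖ ≤ c) →
      Summable (fun i => ‖y i‖) → (∀ i, ‖y i‖ ≤ c) →
      ShiftedSchur.IsBoundedMatrix (ShiftedSchur.toeplitzMatrix (ShiftedSchur.phi x y)) ∧
      ShiftedSchur.IsBoundedMatrix (ShiftedSchur.toeplitzMatrix (ShiftedSchur.phi x y)⁻¹) ∧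
      ShiftedSchur.IsTraceClass (ShiftedSchur.L r s x * ShiftedSchur.L r s y) ∧
      ShiftedSchur.IsTraceClass
        (ShiftedSchur.T (ShiftedSchur.phi x y) * ShiftedSchur.T (ShiftedSchur.phi x y)⁻¹ - 1) ∧
      Multipliable
        (fun p : ℕ × ℕ => (1 + x p.1 * y p.2) / (1 - x p.1 * y p.2)) ∧
      ShiftedSchur.fredholmDet (1 + ShiftedSchur.L r s x * ShiftedSchur.L r s y) =
        ShiftedSchur.fredholmDet
          (ShiftedSchur.T (ShiftedSchur.phi x y) * ShiftedSchur.T (ShiftedSchur.phi x y)⁻¹) ∧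
      ShiftedSchur.fredholmDet (1 + ShiftedSchur.L r s x * ShiftedSchur.L r s y) =
        ShiftedSchur.Z x y ^ 2) := by
  constructor
  · intro x hxs hxb
    have hx : ShiftedSchur.Admissible c x := ⟨hxs, hxb⟩
    have wx := hx.isAnalyticWiener_Q hc
    have wx' := hx.neg.isAnalyticWiener_Q hc
    have hL := hx.hasMatrix_L hc hr hs hrs hrc hsc
    have hi := hx.inv_Q_circle hc
    have hti := hx.inv_tilde_Q_circle hc
    refine ⟨⟨_, hL⟩, wx.isBoundedMatrix_hankel,
      (wx'.1.congr fun z hz => (hi z hz).symm).isBoundedMatrix_hankel,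
      wx.tilde.isBoundedMatrix_toeplitz,
      (wx'.tilde.congr fun z hz => (hti z hz).symm).isBoundedMatrix_toeplitz,
      ShiftedSchur.isBoundedMatrix_signMatrix, ?_, ?_⟩
    · rw [ShiftedSchur.L, hL.matrixOp_eq, ShiftedSchur.T_congr hti]
    · rw [ShiftedSchur.L, hL.matrixOp_eq, hx.H_mul_T_mul_J hc, ShiftedSchur.H_congr hi]
  · intro x y hxs hxb hys hyb
    have hx : ShiftedSchur.Admissible c x := ⟨hxs, hxb⟩
    have hy : ShiftedSchur.Admissible c y := ⟨hys, hyb⟩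
    obtain ⟨wphi, hT⟩ := hx.T_phi hc hy
    obtain ⟨wphi', hT'⟩ := hx.neg.T_phi hc hy.neg
    have hi := hx.inv_phi_circle hc hy
    have hLx := (hx.hasMatrix_L hc hr hs hrs hrc hsc).matrixOp_eq
    have hLy := (hy.hasMatrix_L hc hr hs hrs hrc hsc).matrixOp_eq
    have hcomm : ShiftedSchur.T (ShiftedSchur.phi x y) * ShiftedSchur.T (ShiftedSchur.phi x y)⁻¹ =
        ShiftedSchur.T (ShiftedSchur.tilde (ShiftedSchur.Q y)) * ShiftedSchur.T (ShiftedSchur.Q x) *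
          ShiftedSchur.T (ShiftedSchur.tilde (ShiftedSchur.Q (-y))) *
          ShiftedSchur.T (ShiftedSchur.Q (-x)) := by
      rw [← ShiftedSchur.T_congr hi, hT, hT', ← mul_assoc]
    have hdet : ShiftedSchur.fredholmDet (1 + ShiftedSchur.L r s x * ShiftedSchur.L r s y) =
        ShiftedSchur.commDet x y := by
      rw [ShiftedSchur.L, ShiftedSchur.L, hLx, hLy, hx.fredholmDet_L_mul_L hc hy]
    refine ⟨wphi.isBoundedMatrix_toeplitz, (wphi'.congr hi).isBoundedMatrix_toeplitz, ?_, ?_,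
      hx.multipliable_Z hc hy, ?_, ?_⟩
    · rw [ShiftedSchur.L, ShiftedSchur.L, hLx, hLy, hy.L_mul_L hc]
      exact ((hx.summOp_L_mul_L hc hy).mul_right
        (hy.isAnalyticWiener_Q hc).tilde.isSchur_T).isTraceClass
    · have wx := hx.isAnalyticWiener_Q hc
      have wx' := hx.neg.isAnalyticWiener_Q hc
      rw [hcomm, hy.commutator_eq hc wx wx' (hx.Q_mul_Q_neg_circle hc), add_sub_cancel_left]
      exact (hy.summOp_commutator hc wx wx').isTraceClass
    · rw [hdet, hcomm, ShiftedSchur.commDet]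
    · rw [hdet, hx.commDet_eq hc hy]
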